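/- **Theorem 1.2.** Let $\rho\ge 1$ be an integer, let $r>0$ be real, and let $\mathcal B\subset\mathbb Z\times\{0\}$ be finite. Each vertex of $\mathbb Z^2$ is initially, independently of the others, blue with probability $p$, red with probability $q$ and empty with probability $1-p-q$, where $p,q\ge 0$ and $p+q\le 1$. At times $1,2,3,\dots$ every empty vertex $x$ such that $x+\mathcal B$ contains a blue vertex becomes blue. At times $r,2r,3r,\dots$ every empty vertex $x$ such that $x+\mathcal R$ contains a red vertex becomes red, where $\mathcal R=\{x\in\mathbb Z^2:\|x\|_1\le\rho\}$. If both rules apply to a vertex at the same time, an independent fair coin flip decides its colour. Coloured vertices keep their colour forever. Write $\mathbb P$ for the law of this process, $0$ for the origin and $e_1=(1,0)$. (1) If $e_1\in\mathcal B$ and $p,q$ are not both zero, then almost surely every vertex of $\mathbb Z^2$ is eventually nonempty. In (2) and (3), $q=a\,p^{1+\rho/(\rho+1)}$ with a constant $a>0$, and the limits are taken as $p\downarrow 0$ with $\rho$, $r$, $\mathcal B$ and $a$ fixed. (2) Let $\mathcal B=([-\tau,\tau]\cap\mathbb Z)\times\{0\}$ with an integer $\tau\ge 1$. Then for every $a>0$,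 $$\limsup_{p\to 0}\mathbb P(0\text{ is eventually blue})<1,$$ and this $\limsup$ tends to $0$ as $a\to\infty$. (3) Let $\mathcal B=\{e_1\}$. Then for every $a>0$, $$\liminf_{p\to 0}\mathbb P(0\text{ is eventually blue})>0,$$ and this $\liminf$ tends to $1$ as $a\to 0$. -/

import Mathlib

open MeasureTheory Filter Topology

namespace CompetingGrowth

/-- The three possible states of a vertex. -/
inductive Colour : Type
  | empty
  | blue
  | red

instance : MeasurableSpace Colour := ⊤

/-- The randomness: every vertex of `ℤ²` carries its initial colour and a coin, which decides a
tie at that vertex (`true` means blue). As a vertex changes its state at most once, at most one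
tie is ever decided at each vertex, so one coin for each vertex is enough. -/
abbrev Sample : Type := ℤ × ℤ → Colour × Bool

/-- The law of one initial colour: blue with probability `p`, red with probability `q`, and empty
with probability `1 - p - q`. It is used for `0 ≤ p`, `0 ≤ q`, `p + q ≤ 1`. -/
noncomputable def colourLaw (p q : ℝ) : Measure Colour :=
  ENNReal.ofReal p • Measure.dirac Colour.blue + ENNReal.ofReal q • Measure.dirac Colour.red
    + ENNReal.ofReal (1 - p - q) • Measure.dirac Colour.empty

/-- The law of a fair coin. -/
noncomputable def coinLaw : Measure Bool :=
  ENNReal.ofReal (1 / 2) • Measure.dirac true + ENNReal.ofReal (1 / 2) • Measure.dirac false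

/-- The probability measure of the model: all initial colours and all coins are independent. -/
noncomputable def law (p q : ℝ) : Measure Sample :=
  Measure.infinitePi fun _ : ℤ × ℤ => (colourLaw p q).prod coinLaw

theorem isProbabilityMeasure_colourLaw {p q : ℝ} (hp : 0 ≤ p) (hq : 0 ≤ q) (hpq : p + q ≤ 1) :
    IsProbabilityMeasure (colourLaw p q) := by
  constructor
  simp only [colourLaw, Measure.coe_add, Measure.coe_smul, Pi.add_apply, Pi.smul_apply,
    measure_univ, smul_eq_mul, mul_one]
  rw [← ENNReal.ofReal_add hp hq, ← ENNReal.ofReal_add (by linarith) (by linarith)]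
  simp

theorem isProbabilityMeasure_coinLaw : IsProbabilityMeasure coinLaw := by
  constructor
  simp only [coinLaw, Measure.coe_add, Measure.coe_smul, Pi.add_apply, Pi.smul_apply,
    measure_univ, smul_eq_mul, mul_one]
  rw [← ENNReal.ofReal_add (by norm_num) (by norm_num)]
  norm_num

theorem isProbabilityMeasure_law {p q : ℝ} (hp : 0 ≤ p) (hq : 0 ≤ q) (hpq : p + q ≤ 1) :
    IsProbabilityMeasure (law p q) := by
  have := isProbabilityMeasure_colourLaw hp hq hpq
  have := isProbabilityMeasure_coinLaw
  unfold law
  infer_instance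

/-- Blue updates at the times `1, 2, 3, …`. -/
def IsBlueTime (t : ℝ) : Prop := ∃ m : ℕ, 1 ≤ m ∧ t = m

/-- Red updates at the times `r, 2r, 3r, …`. -/
def IsRedTime (r t : ℝ) : Prop := ∃ m : ℕ, 1 ≤ m ∧ t = r * m

/-- The successive update times, `0 = T 0 < T 1 < T 2 < …`: after `T n`, the next update takes
place at the first positive integer or the first positive multiple of `r` that exceeds `T n`,
whichever comes first. -/
noncomputable def updateTime (r : ℝ) : ℕ → ℝ
  | 0 => 0
  | n + 1 => min ((⌊updateTime r n⌋₊ + 1 : ℕ) : ℝ) (r * (⌊updateTime r n / r⌋₊ + 1 : ℕ))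

open Classical in
/-- The simultaneous update of all vertices at time `t`, from the configuration `η` just before
`t`: an empty vertex `x` becomes blue if `t` is a time of blue and `x + B` holds a blue vertex, it
becomes red if `t` is a time of red and `x + R` holds a red vertex, and if both apply its coin
decides. Coloured vertices keep their colour. -/
noncomputable def update (r : ℝ) (B R : Set (ℤ × ℤ)) (coin : ℤ × ℤ → Bool) (t : ℝ)
    (η : ℤ × ℤ → Colour) : ℤ × ℤ → Colour := fun x =>
  if η x ≠ Colour.empty then η x
  else if IsBlueTime t ∧ ∃ b ∈ B, η (x + b) = Colour.blue then
    if IsRedTime r t ∧ ∃ d ∈ R, η (x + d) = Colour.red then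
      if coin x = true then Colour.blue else Colour.red
    else Colour.blue
  else if IsRedTime r t ∧ ∃ d ∈ R, η (x + d) = Colour.red then Colour.red
  else Colour.empty

/-- The configuration after `n` updates: `config r B R ω n` is the state `ξ_t` of the process at
all times `t` with `updateTime r n ≤ t < updateTime r (n + 1)`. -/
noncomputable def config (r : ℝ) (B R : Set (ℤ × ℤ)) (ω : Sample) : ℕ → ℤ × ℤ → Colour
  | 0 => fun x => (ω x).1
  | n + 1 => update r B R (fun x => (ω x).2) (updateTime r (n + 1)) (config r B R ω n)

/-- The vertex `x` is eventually blue. -/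
def EventuallyBlue (r : ℝ) (B R : Set (ℤ × ℤ)) (ω : Sample) (x : ℤ × ℤ) : Prop :=
  ∃ n, config r B R ω n x = Colour.blue

/-- The vertex `x` is eventually nonempty. -/
def EventuallyNonempty (r : ℝ) (B R : Set (ℤ × ℤ)) (ω : Sample) (x : ℤ × ℤ) : Prop :=
  ∃ n, config r B R ω n x ≠ Colour.empty

/-- The `ℓ¹`-ball of radius `ρ` around the origin of `ℤ²`. -/
def l1Ball (ρ : ℕ) : Set (ℤ × ℤ) := {x | |x.1| + |x.2| ≤ (ρ : ℤ)}

/-- The horizontal segment `([-τ, τ] ∩ ℤ) × {0}`. -/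
def segment (τ : ℕ) : Set (ℤ × ℤ) := {x | |x.1| ≤ (τ : ℤ) ∧ x.2 = 0}

/-- The probability that the origin is eventually blue. -/
noncomputable def probBlue (r : ℝ) (B R : Set (ℤ × ℤ)) (p q : ℝ) : ℝ :=
  (law p q).real {ω | EventuallyBlue r B R ω (0, 0)}

end CompetingGrowth

/-! If a vertex stays empty forever, then so does its right neighbour, because both colours can step
from `(1, 0)` to the origin. A whole half-line would then be empty initially, which has probability
zero. For the asymptotics put `p = h ^ (ρ + 1)`, so that `q = a * h ^ (2 * ρ + 1)`. The nearest blue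
vertex in row 0 is at distance of order `1 / p`. Among `h ^ (-ρ)` rows one expects order one run of
`ρ` consecutive rows that each hold a blue vertex within distance `h ^ (-ρ)`, and only such a run
can stop red, whose jumps have length `ρ`. A box of width `1 / p` and height `h ^ (-ρ)` holds about
`a` red vertices, so `a` decides the competition. Red wins (`probBlue_le`, `exists_probBlue_le`): in
a box scaled down by `s` there is a red vertex with probability about `1 - exp (-a s²)`. It descends
its column and then follows row 0 to the origin before blue interferes, except with probability
`O(s)` (`not_eventuallyBlue_of_red`, `prob_obstacle_le`). Exploring the box from the top keeps the
rows below the chosen red vertex unexposed. Blue wins (`le_abs_of_red`, `le_probBlue`,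
`exists_le_probBlue`): suppose that a box holds no red, at a cost `exp (-a K)`. Blue spreads to the
left, so `ρ` consecutive rows with a blue vertex on the right grow into a wall that red cannot jump
over. Time is cut into layers of doubling scales, and a red-free strip around row 0 gives up some
rows in each layer. At scale `i` about `a 2^i` red vertices matter, while a cell of width about `2^i
h ^ (-ρ)` lacks a wall with probability at most of order `G⁻³ (27/64)^i`, where `G` measures the
rows given up. The sum over `i` is `O(a / G³)`: a large `G` gives a positive limit for each `a`, and
`a → 0` gives the limit 1. -/

namespace CompetingGrowth

/-! ### The two clocks: counting blue and red updates -/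

section Times

/-- The number of blue times among the first `n` update times. -/
noncomputable def blueCount (r : ℝ) (n : ℕ) : ℕ := ⌊updateTime r n⌋₊

/-- The number of red times among the first `n` update times. -/
noncomputable def redCount (r : ℝ) (n : ℕ) : ℕ := ⌊updateTime r n / r⌋₊

variable {r : ℝ}

theorem updateTime_succ (n : ℕ) : updateTime r (n + 1) =
    min ((blueCount r n : ℝ) + 1) (r * ((redCount r n : ℝ) + 1)) := by
  simp [updateTime, blueCount, redCount]

theorem updateTime_nonneg (hr : 0 < r) (n : ℕ) : 0 ≤ updateTime r n := by
  cases n with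
  | zero => simp [updateTime]
  | succ n => rw [updateTime_succ]; positivity

theorem blueCount_le (hr : 0 < r) (n : ℕ) : (blueCount r n : ℝ) ≤ updateTime r n :=
  Nat.floor_le (updateTime_nonneg hr n)

theorem lt_blueCount_add_one (n : ℕ) : updateTime r n < blueCount r n + 1 :=
  Nat.lt_floor_add_one _

theorem mul_redCount_le (hr : 0 < r) (n : ℕ) : r * redCount r n ≤ updateTime r n := by
  rw [mul_comm, ← le_div_iff₀ hr]
  exact Nat.floor_le (div_nonneg (updateTime_nonneg hr n) hr.le)

theorem lt_mul_redCount_add_one (hr : 0 < r) (n : ℕ) :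
    updateTime r n < r * (redCount r n + 1) := by
  rw [mul_comm, ← div_lt_iff₀ hr]
  exact Nat.lt_floor_add_one _

theorem updateTime_lt_succ (hr : 0 < r) (n : ℕ) : updateTime r n < updateTime r (n + 1) := by
  rw [updateTime_succ]
  exact lt_min (lt_blueCount_add_one n) (lt_mul_redCount_add_one hr n)

theorem blueCount_zero : blueCount r 0 = 0 := by simp [blueCount, updateTime]

theorem redCount_zero : redCount r 0 = 0 := by simp [redCount, updateTime]

theorem blueCount_succ (hr : 0 < r) (n : ℕ) :
    (IsBlueTime (updateTime r (n + 1)) ∧ blueCount r (n + 1) = blueCount r n + 1) ∨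
    (¬ IsBlueTime (updateTime r (n + 1)) ∧ blueCount r (n + 1) = blueCount r n) := by
  have h1 := updateTime_succ (r := r) n
  have h2 := blueCount_le hr n
  have h3 := updateTime_lt_succ hr n
  rcases le_or_gt ((blueCount r n : ℝ) + 1) (r * ((redCount r n : ℝ) + 1)) with h | h
  · left
    rw [min_eq_left h] at h1
    refine ⟨⟨blueCount r n + 1, by omega, by rw [h1]; push_cast; rfl⟩, ?_⟩
    rw [blueCount, h1]
    exact_mod_cast Nat.floor_natCast (blueCount r n + 1)
  · right
    have h4 : updateTime r (n + 1) < blueCount r n + 1 := by rw [h1]; exact min_lt_of_right_lt h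
    refine ⟨?_, ?_⟩
    · rintro ⟨k, _, hk⟩
      rw [hk] at h4 h3
      have h5 : k < blueCount r n + 1 := by exact_mod_cast h4
      have h6 : blueCount r n < k := by exact_mod_cast h2.trans_lt h3
      omega
    · rw [blueCount, Nat.floor_eq_iff (updateTime_nonneg hr _)]
      exact ⟨h2.trans h3.le, h4⟩

theorem redCount_succ (hr : 0 < r) (n : ℕ) :
    (IsRedTime r (updateTime r (n + 1)) ∧ redCount r (n + 1) = redCount r n + 1) ∨
    (¬ IsRedTime r (updateTime r (n + 1)) ∧ redCount r (n + 1) = redCount r n) := by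
  have h1 := updateTime_succ (r := r) n
  have h2 := mul_redCount_le hr n
  have h3 := updateTime_lt_succ hr n
  rcases le_or_gt (r * ((redCount r n : ℝ) + 1)) ((blueCount r n : ℝ) + 1) with h | h
  · left
    rw [min_eq_right h] at h1
    refine ⟨⟨redCount r n + 1, by omega, by rw [h1]; push_cast; rfl⟩, ?_⟩
    rw [redCount, h1, mul_div_cancel_left₀ _ hr.ne']
    exact_mod_cast Nat.floor_natCast (redCount r n + 1)
  · right
    have h4 : updateTime r (n + 1) < r * (redCount r n + 1) := by
      rw [h1]; exact min_lt_of_left_lt h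
    refine ⟨?_, ?_⟩
    · rintro ⟨k, _, hk⟩
      rw [hk] at h4 h3
      have h5 : k < redCount r n + 1 := by exact_mod_cast lt_of_mul_lt_mul_left h4 hr.le
      have h6 : redCount r n < k := by
        exact_mod_cast lt_of_mul_lt_mul_left (h2.trans_lt h3) hr.le
      omega
    · rw [redCount, Nat.floor_eq_iff (div_nonneg (updateTime_nonneg hr _) hr.le),
        le_div_iff₀ hr, div_lt_iff₀ hr, mul_comm, mul_comm _ r]
      exact ⟨h2.trans h3.le, h4⟩

theorem blueCount_le_succ (hr : 0 < r) (n : ℕ) : blueCount r n ≤ blueCount r (n + 1) := by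
  rcases blueCount_succ hr n with h | h <;> omega

theorem redCount_le_succ (hr : 0 < r) (n : ℕ) : redCount r n ≤ redCount r (n + 1) := by
  rcases redCount_succ hr n with h | h <;> omega

theorem redCount_mono (hr : 0 < r) : Monotone (redCount r) :=
  monotone_nat_of_le_succ (redCount_le_succ hr)

theorem blueCount_mono (hr : 0 < r) : Monotone (blueCount r) :=
  monotone_nat_of_le_succ (blueCount_le_succ hr)

/-- Both counts read the same time, so each clock bounds the other. This turns a number of red
updates into a distance travelled by blue. -/
theorem blueCount_le_mul (hr : 0 < r) (n : ℕ) :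
    (blueCount r n : ℝ) ≤ r * (redCount r n + 1) :=
  (blueCount_le hr n).trans (lt_mul_redCount_add_one hr n).le

theorem mul_redCount_le_blueCount (hr : 0 < r) (n : ℕ) :
    r * redCount r n ≤ blueCount r n + 1 :=
  (mul_redCount_le hr n).trans (lt_blueCount_add_one n).le

theorem le_blueCount_add_redCount (hr : 0 < r) (n : ℕ) : n ≤ blueCount r n + redCount r n := by
  induction n with
  | zero => simp
  | succ n ih =>
    by_contra hcon
    have hb := blueCount_succ hr n
    have hc := redCount_succ hr n
    have hnb : ¬ IsBlueTime (updateTime r (n + 1)) := by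
      intro h; rcases hb with h' | h' <;> [skip; exact h'.1 h]
      rcases hc with h'' | h'' <;> omega
    have hnc : ¬ IsRedTime r (updateTime r (n + 1)) := by
      intro h; rcases hc with h' | h' <;> [skip; exact h'.1 h]
      rcases hb with h'' | h'' <;> omega
    have h1 := updateTime_succ (r := r) n
    rcases min_choice ((blueCount r n : ℝ) + 1) (r * ((redCount r n : ℝ) + 1)) with h | h
    · exact hnb ⟨blueCount r n + 1, by omega, by rw [h1, h]; push_cast; rfl⟩
    · exact hnc ⟨redCount r n + 1, by omega, by rw [h1, h]; push_cast; rfl⟩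

theorem exists_le_redCount (hr : 0 < r) (k : ℕ) : ∃ n, k ≤ redCount r n := by
  by_contra! h
  obtain ⟨n, hn⟩ := exists_nat_gt ((k : ℝ) + r * (k + 1))
  have h1 := le_blueCount_add_redCount hr n
  have h2 := blueCount_le_mul hr n
  have h3 : (redCount r n : ℝ) ≤ k := by exact_mod_cast (h n).le
  have h4 : (n : ℝ) ≤ blueCount r n + redCount r n := by exact_mod_cast h1
  nlinarith [mul_le_mul_of_nonneg_left h3 hr.le]

theorem exists_le_blueCount (hr : 0 < r) (k : ℕ) : ∃ n, k ≤ blueCount r n := by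
  obtain ⟨j, hj⟩ := exists_nat_gt (((k : ℝ) + 1) / r)
  obtain ⟨n, hn⟩ := exists_le_redCount hr j
  refine ⟨n, ?_⟩
  have h2 := mul_redCount_le_blueCount hr n
  rw [div_lt_iff₀ hr] at hj
  have h3 : (j : ℝ) ≤ redCount r n := by exact_mod_cast hn
  have : (k : ℝ) ≤ blueCount r n := by nlinarith [mul_le_mul_of_nonneg_left h3 hr.le]
  exact_mod_cast this

/-- A discrete intermediate value property: the red clock starts at 0 and advances by at most one
per update. -/
theorem exists_redCount_eq (hr : 0 < r) {n k : ℕ} (h : k ≤ redCount r n) :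
    ∃ l ≤ n, redCount r l = k := by
  induction n with
  | zero => exact ⟨0, le_rfl, by rw [redCount_zero] at *; omega⟩
  | succ n ih =>
    rcases redCount_succ hr n with h' | h'
    · by_cases hk : k ≤ redCount r n
      · obtain ⟨l, hl, e⟩ := ih hk; exact ⟨l, by omega, e⟩
      · exact ⟨n + 1, le_rfl, by omega⟩
    · obtain ⟨l, hl, e⟩ := ih (by omega); exact ⟨l, by omega, e⟩

/-- After any update there is a later blue update. -/
theorem exists_isBlueTime (hr : 0 < r) (n : ℕ) : ∃ m ≥ n, IsBlueTime (updateTime r (m + 1)) := by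
  by_contra! h
  have : ∀ m ≥ n, blueCount r m = blueCount r n := by
    intro m hm
    induction m, hm using Nat.le_induction with
    | base => rfl
    | succ m hm ih =>
      rcases blueCount_succ hr m with h' | h'
      · exact absurd h'.1 (h m hm)
      · rw [h'.2, ih]
  obtain ⟨l, hl⟩ := exists_le_blueCount hr (blueCount r n + 1)
  have h2 := this (max l n) (le_max_right _ _)
  have h3 := blueCount_mono hr (le_max_left l n)
  omega

/-- After any update there is a later red update. -/
theorem exists_isRedTime (hr : 0 < r) (n : ℕ) : ∃ m ≥ n, IsRedTime r (updateTime r (m + 1)) := by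
  by_contra! h
  have : ∀ m ≥ n, redCount r m = redCount r n := by
    intro m hm
    induction m, hm using Nat.le_induction with
    | base => rfl
    | succ m hm ih =>
      rcases redCount_succ hr m with h' | h'
      · exact absurd h'.1 (h m hm)
      · rw [h'.2, ih]
  obtain ⟨l, hl⟩ := exists_le_redCount hr (redCount r n + 1)
  have h2 := this (max l n) (le_max_right _ _)
  have h3 := redCount_mono hr (le_max_left l n)
  omega

end Times

/-! ### Deterministic dynamics: speed bounds and ancestry of both colours -/

section Dynamics

variable {r : ℝ} {B R : Set (ℤ × ℤ)} {ω : Sample}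

theorem config_succ_of_ne_empty {n : ℕ} {x : ℤ × ℤ} (h : config r B R ω n x ≠ Colour.empty) :
    config r B R ω (n + 1) x = config r B R ω n x := by
  simp [config, update, h]

theorem config_eq_of_le {n m : ℕ} (hnm : n ≤ m) {x : ℤ × ℤ} {col : Colour}
    (h : config r B R ω n x = col) (hcol : col ≠ Colour.empty) :
    config r B R ω m x = col := by
  induction m, hnm using Nat.le_induction with
  | base => exact h
  | succ m _ ih => rw [config_succ_of_ne_empty (by rw [ih]; exact hcol), ih]

theorem config_ne_empty_of_le {n m : ℕ} (hnm : n ≤ m) {x : ℤ × ℤ}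
    (h : config r B R ω n x ≠ Colour.empty) : config r B R ω m x ≠ Colour.empty := by
  rw [config_eq_of_le hnm rfl h]; exact h

theorem blue_succ_cases {n : ℕ} {x : ℤ × ℤ} (h : config r B R ω (n + 1) x = Colour.blue) :
    config r B R ω n x = Colour.blue ∨
    (IsBlueTime (updateTime r (n + 1)) ∧ ∃ b ∈ B, config r B R ω n (x + b) = Colour.blue) := by
  by_cases h0 : config r B R ω n x = Colour.empty
  · right
    by_contra hc
    rw [config, update] at h
    simp only [h0, hc] at h
    split_ifs at h <;> contradiction
  · left; rw [← config_succ_of_ne_empty h0, h]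

theorem red_succ_cases {n : ℕ} {x : ℤ × ℤ} (h : config r B R ω (n + 1) x = Colour.red) :
    config r B R ω n x = Colour.red ∨
    (IsRedTime r (updateTime r (n + 1)) ∧ ∃ d ∈ R, config r B R ω n (x + d) = Colour.red) := by
  by_cases h0 : config r B R ω n x = Colour.empty
  · right
    by_contra hc
    rw [config, update] at h
    simp only [h0, hc] at h
    split_ifs at h <;> contradiction
  · left; rw [← config_succ_of_ne_empty h0, h]

theorem ne_empty_of_blue {n : ℕ} {x b : ℤ × ℤ} (ht : IsBlueTime (updateTime r (n + 1)))
    (hb : b ∈ B) (h : config r B R ω n (x + b) = Colour.blue) :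
    config r B R ω (n + 1) x ≠ Colour.empty := by
  have : ∃ b ∈ B, config r B R ω n (x + b) = Colour.blue := ⟨b, hb, h⟩
  rw [config, update]
  simp only [ht, this]
  split_ifs <;> simp_all

theorem ne_empty_of_red {n : ℕ} {x d : ℤ × ℤ} (ht : IsRedTime r (updateTime r (n + 1)))
    (hd : d ∈ R) (h : config r B R ω n (x + d) = Colour.red) :
    config r B R ω (n + 1) x ≠ Colour.empty := by
  have : ∃ d ∈ R, config r B R ω n (x + d) = Colour.red := ⟨d, hd, h⟩
  rw [config, update]
  simp only [ht, this]
  split_ifs <;> simp_all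

theorem eq_red_of_ne {c : Colour} (h1 : c ≠ Colour.empty) (h2 : c ≠ Colour.blue) :
    c = Colour.red := by cases c <;> simp_all

theorem eq_blue_of_ne {c : Colour} (h1 : c ≠ Colour.empty) (h2 : c ≠ Colour.red) :
    c = Colour.blue := by cases c <;> simp_all

/-- Blue spreads within rows, by at most `τ` per blue time. -/
theorem exists_initial_blue {τ : ℕ} (hr : 0 < r) {n : ℕ} {x : ℤ × ℤ}
    (h : config r (segment τ) R ω n x = Colour.blue) :
    ∃ z : ℤ, (ω (z, x.2)).1 = Colour.blue ∧ |z - x.1| ≤ τ * blueCount r n := by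
  induction n generalizing x with
  | zero => exact ⟨x.1, h, by simp [blueCount_zero]⟩
  | succ n ih =>
    have hm := blueCount_le_succ hr n
    rcases blue_succ_cases h with h' | ⟨ht, b, hb, h'⟩
    · obtain ⟨z, hz, hd⟩ := ih h'
      exact ⟨z, hz, hd.trans (by gcongr)⟩
    · obtain ⟨z, hz, hd⟩ := ih h'
      obtain ⟨hb1, hb2⟩ := hb
      refine ⟨z, by simpa [hb2] using hz, ?_⟩
      have h2 : blueCount r (n + 1) = blueCount r n + 1 := by
        rcases blueCount_succ hr n with h | h
        · exact h.2
        · exact absurd ht h.1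
      rw [h2]
      push_cast
      calc |z - x.1| = |(z - (x + b).1) + b.1| := by rw [Prod.fst_add]; congr 1; ring
        _ ≤ |z - (x + b).1| + |b.1| := abs_add_le _ _
        _ ≤ τ * blueCount r n + τ := add_le_add hd hb1
        _ = _ := by ring

/-- Genealogy of a red vertex. -/
theorem exists_red_path (hr : 0 < r) {ρ n : ℕ} {x : ℤ × ℤ}
    (h : config r B (l1Ball ρ) ω n x = Colour.red) :
    ∃ γ : ℕ → ℤ × ℤ, γ n = x ∧ (∀ k ≤ n, config r B (l1Ball ρ) ω k (γ k) = Colour.red) ∧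
      ∀ k < n, |(γ (k + 1)).1 - (γ k).1| + |(γ (k + 1)).2 - (γ k).2| ≤
        ρ * ((redCount r (k + 1) : ℤ) - redCount r k) := by
  induction n generalizing x with
  | zero => exact ⟨fun _ => x, rfl, fun k hk => by rwa [Nat.le_zero.1 hk], by simp⟩
  | succ n ih =>
    have key : ∃ y, config r B (l1Ball ρ) ω n y = Colour.red ∧
        |x.1 - y.1| + |x.2 - y.2| ≤ ρ * ((redCount r (n + 1) : ℤ) - redCount r n) := by
      rcases red_succ_cases h with h' | ⟨ht, d, hd, h'⟩
      · refine ⟨x, h', ?_⟩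
        have := redCount_le_succ hr n
        simp only [sub_self, abs_zero, add_zero]
        exact mul_nonneg (by positivity) (by omega)
      · refine ⟨x + d, h', ?_⟩
        have h2 : redCount r (n + 1) = redCount r n + 1 := by
          rcases redCount_succ hr n with h | h
          · exact h.2
          · exact absurd ht h.1
        have hd' : |d.1| + |d.2| ≤ (ρ : ℤ) := hd
        rw [h2]
        push_cast
        simpa [abs_neg] using hd'
    obtain ⟨y, hy, hd⟩ := key
    obtain ⟨γ, h1, h2, h3⟩ := ih hy
    refine ⟨fun k => if k ≤ n then γ k else x, by simp, fun k hk => ?_, fun k hk => ?_⟩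
    · by_cases hkn : k ≤ n
      · simpa [hkn] using h2 k hkn
      · have : k = n + 1 := by omega
        subst this; simpa using h
    · by_cases hkn : k < n
      · have h4 : k + 1 ≤ n := hkn
        simpa [hkn.le, h4] using h3 k hkn
      · have : k = n := by omega
        subst this; simpa [h1] using hd

theorem path_dist {ρ n : ℕ} {γ : ℕ → ℤ × ℤ}
    (h : ∀ k < n, |(γ (k + 1)).1 - (γ k).1| + |(γ (k + 1)).2 - (γ k).2| ≤
        ρ * ((redCount r (k + 1) : ℤ) - redCount r k)) {k l : ℕ} (hkl : k ≤ l) (hl : l ≤ n) :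
    |(γ l).1 - (γ k).1| + |(γ l).2 - (γ k).2| ≤ ρ * ((redCount r l : ℤ) - redCount r k) := by
  induction l, hkl using Nat.le_induction with
  | base => simp
  | succ l hkl ih =>
    have h1 := ih (by omega)
    have h2 := h l (by omega)
    have h3 := abs_sub_le (γ (l + 1)).1 (γ l).1 (γ k).1
    have h4 := abs_sub_le (γ (l + 1)).2 (γ l).2 (γ k).2
    have : (ρ : ℤ) * ((redCount r (l + 1) : ℤ) - redCount r k) =
      ρ * ((redCount r (l + 1) : ℤ) - redCount r l) + ρ * ((redCount r l : ℤ) - redCount r k) := by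
      ring
    linarith

/-- With `B = {(1, 0)}`, an initially blue vertex spreads to the left at unit speed along vertices
that are not red. -/
theorem blue_of_initial_blue (hr : 0 < r) {n : ℕ} {z y : ℤ} (hz : (ω (z, y)).1 = Colour.blue)
    {k : ℕ} (hk : k ≤ blueCount r n)
    (h : ∀ j ≤ k, config r {(1, 0)} R ω n (z - j, y) ≠ Colour.red) :
    config r {(1, 0)} R ω n (z - k, y) = Colour.blue := by
  induction n generalizing k with
  | zero =>
    rw [blueCount_zero] at hk
    obtain rfl : k = 0 := by omega
    simpa [config] using hz
  | succ n ih =>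
    -- Red is permanent, so the absence of red at the last step passes to all earlier steps.
    have h' : ∀ j ≤ k, config r {(1, 0)} R ω n (z - j, y) ≠ Colour.red := fun j hj hc =>
      h j hj (config_eq_of_le (Nat.le_succ n) hc (by simp))
    by_cases hkn : k ≤ blueCount r n
    · exact config_eq_of_le (Nat.le_succ n) (ih hkn h') (by simp)
    · rcases blueCount_succ hr n with hb | hb
      · obtain ⟨k', rfl⟩ : ∃ k', k = k' + 1 := ⟨k - 1, by omega⟩
        have h1 := ih (k := k') (by omega) fun j hj => h' j (by omega)
        refine eq_blue_of_ne (ne_empty_of_blue hb.1 (b := (1, 0)) rfl ?_) (h _ le_rfl)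
        rw [← h1]
        congr 1
        ext <;> simp
        ring
      · omega

/-- If `u` is red by the `k`-th red time, then any `u'` in its range which cannot be blue until a
later red time is red from that time on. -/
theorem red_step (hr : 0 < r) {ρ k k' : ℕ} {u u' : ℤ × ℤ} (hk : k < k')
    (hu : ∀ n, k ≤ redCount r n → config r B (l1Ball ρ) ω n u = Colour.red)
    (hd : |u.1 - u'.1| + |u.2 - u'.2| ≤ ρ)
    (hb : ∀ n, redCount r n ≤ k' → config r B (l1Ball ρ) ω n u' ≠ Colour.blue)
    {n : ℕ} (hn : k' ≤ redCount r n) : config r B (l1Ball ρ) ω n u' = Colour.red := by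
  obtain ⟨l, hl, he⟩ := exists_redCount_eq hr hn
  obtain ⟨l', hl', he'⟩ := exists_redCount_eq hr (n := l) (k := k) (by omega)
  suffices h : ∃ s ≤ l, config r B (l1Ball ρ) ω s u' ≠ Colour.empty by
    obtain ⟨s, hs, h⟩ := h
    have h2 := config_ne_empty_of_le hs h
    exact config_eq_of_le hl (eq_red_of_ne h2 (hb l he.le)) (by simp)
  have hlt : l' < l := by
    rcases hl'.lt_or_eq with h | h
    · exact h
    · subst h; omega
  -- The red clock rises from `k` to `k'` between `l'` and `l`, so a red update falls in between. It
  -- colours `u'`, and `hb` excludes blue even if there is a tie.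
  have : ∃ s, l' ≤ s ∧ s < l ∧ IsRedTime r (updateTime r (s + 1)) := by
    by_contra! hcon
    have : ∀ s, l' ≤ s → s ≤ l → redCount r s = redCount r l' := by
      intro s hs
      induction s, hs using Nat.le_induction with
      | base => intro; rfl
      | succ s hs ih =>
        intro hsl
        rcases redCount_succ hr s with h | h
        · exact absurd h.1 (hcon s hs (by omega))
        · rw [h.2, ih (by omega)]
    have := this l hlt.le le_rfl
    omega
  obtain ⟨s, hs1, hs2, hs3⟩ := this
  refine ⟨s + 1, hs2, ne_empty_of_red (d := u - u') hs3 hd ?_⟩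
  rw [add_sub_cancel]
  exact hu s (he' ▸ redCount_mono hr hs1)

end Dynamics

/-! ### Independence and conditioning in product measures -/

section Product

open ProbabilityTheory

variable {ι X : Type*} [MeasurableSpace X] {m : ι → Measure X} [∀ i, IsProbabilityMeasure (m i)]

/-- Such an event is the preimage of a subset of the finite space `S → X`, where every set is
measurable. -/
theorem measurableSet_of_dependsOn [Finite X] [MeasurableSingletonClass X] {S : Finset ι}
    {A : Set (ι → X)} (hA : DependsOn (· ∈ A) (S : Set ι)) : MeasurableSet A := by
  have h : A = S.restrict ⁻¹' (S.restrict '' A) := by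
    ext ω
    refine ⟨fun h => ⟨ω, h, rfl⟩, ?_⟩
    rintro ⟨ω', h', he⟩
    have := hA (x := ω') (y := ω) fun i hi => congrFun he ⟨i, hi⟩
    exact this.mp h'
  rw [h]
  exact (Finset.measurable_restrict S) (Set.toFinite _).measurableSet

theorem infinitePi_inter_of_dependsOn [Finite X] [MeasurableSingletonClass X] {S T : Finset ι}
    (hST : Disjoint S T) {A B : Set (ι → X)} (hA : DependsOn (· ∈ A) (S : Set ι))
    (hB : DependsOn (· ∈ B) (T : Set ι)) :
    Measure.infinitePi m (A ∩ B) = Measure.infinitePi m A * Measure.infinitePi m B := by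
  have key : ∀ {S : Finset ι} {A : Set (ι → X)}, DependsOn (· ∈ A) (S : Set ι) →
      A = (fun ω (i : S) => ω i) ⁻¹' (S.restrict '' A) := by
    intro S A hA
    ext ω
    refine ⟨fun h => ⟨ω, h, rfl⟩, ?_⟩
    rintro ⟨ω', h', he⟩
    have := hA (x := ω') (y := ω) fun i hi => congrFun he ⟨i, hi⟩
    exact this.mp h'
  have h := (iIndepFun_infinitePi (P := m) (X := fun _ x => x)
    fun _ => measurable_id).indepFun_finset S T hST fun i => measurable_pi_apply i
  have := h.measure_inter_preimage_eq_mul (S.restrict '' A) (T.restrict '' B)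
    (Set.toFinite _).measurableSet (Set.toFinite _).measurableSet
  rw [← key hA, ← key hB] at this
  exact this

theorem infinitePi_biInter_of_dependsOn [Finite X] [MeasurableSingletonClass X] [DecidableEq ι]
    {κ : Type*} [DecidableEq κ]
    (K : Finset κ) {S : κ → Finset ι} {A : κ → Set (ι → X)}
    (hS : ∀ k ∈ K, ∀ l ∈ K, k ≠ l → Disjoint (S k) (S l))
    (hA : ∀ k ∈ K, DependsOn (· ∈ A k) (S k : Set ι)) :
    Measure.infinitePi m (⋂ k ∈ K, A k) = ∏ k ∈ K, Measure.infinitePi m (A k) := by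
  induction K using Finset.induction_on with
  | empty => simp
  | insert a K ha ih =>
    rw [Finset.prod_insert ha, Finset.set_biInter_insert,
      ← ih (fun k hk l hl => hS k (Finset.mem_insert_of_mem hk) l (Finset.mem_insert_of_mem hl))
        (fun k hk => hA k (Finset.mem_insert_of_mem hk))]
    refine infinitePi_inter_of_dependsOn (S := S a) (T := K.biUnion S) ?_
      (hA a (Finset.mem_insert_self a K)) ?_
    · rw [Finset.disjoint_biUnion_right]
      intro k hk
      exact hS a (Finset.mem_insert_self a K) k (Finset.mem_insert_of_mem hk)
        (by rintro rfl; exact ha hk)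
    · intro x y hxy
      simp only [Set.mem_iInter, eq_iff_iff]
      refine forall₂_congr fun k hk => ?_
      have := hA k (Finset.mem_insert_of_mem hk) (x := x) (y := y) fun i hi =>
        hxy i (Finset.mem_coe.2 (Finset.mem_biUnion.2 ⟨k, hk, hi⟩))
      exact iff_of_eq this

/-- Conditioning a product measure on a finite box conditions its factors. -/
theorem cond_infinitePi [DecidableEq ι] {S : Finset ι} {A : ι → Set X}
    (hA : ∀ i, MeasurableSet (A i)) (hS : ∀ i ∉ S, A i = Set.univ) (h0 : ∀ i, m i (A i) ≠ 0) :
    ProbabilityTheory.cond (Measure.infinitePi m) (Set.pi S A)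
      = Measure.infinitePi fun i => ProbabilityTheory.cond (m i) (A i) := by
  have : ∀ i, IsProbabilityMeasure (ProbabilityTheory.cond (m i) (A i)) :=
    fun i => cond_isProbabilityMeasure (h0 i)
  refine Measure.eq_infinitePi _ fun T t ht => ?_
  classical
  set t' : ι → Set X := fun i => if i ∈ T then t i else Set.univ with ht'
  have hmt : ∀ i, MeasurableSet (t' i) := by
    intro i; by_cases h : i ∈ T <;> simp [ht', h, ht]
  have h1 : Set.pi (T : Set ι) t = Set.pi ((S ∪ T : Finset ι) : Set ι) t' := by
    ext ω
    simp only [Set.mem_pi, Finset.mem_coe, Finset.mem_union, ht']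
    refine ⟨fun h i _ => ?_, fun h i hi => ?_⟩
    · by_cases hi : i ∈ T <;> simp [hi, h]
    · simpa [hi] using h i (Or.inr hi)
  have h2 : Set.pi (S : Set ι) A = Set.pi ((S ∪ T : Finset ι) : Set ι) A := by
    ext ω
    simp only [Set.mem_pi, Finset.mem_coe, Finset.mem_union]
    refine ⟨fun h i _ => ?_, fun h i hi => h i (Or.inl hi)⟩
    by_cases hi : i ∈ S
    · exact h i hi
    · simp [hS i hi]
  have hmB : MeasurableSet (Set.pi ((S ∪ T : Finset ι) : Set ι) A) :=
    MeasurableSet.pi (Finset.countable_toSet _) fun i _ => hA i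
  rw [h2, h1, ProbabilityTheory.cond_apply hmB, ← Set.pi_inter_distrib,
    Measure.infinitePi_pi _ (fun i _ => (hA i)), Measure.infinitePi_pi _
      (fun i _ => (hA i).inter (hmt i))]
  have h3 : ∏ i ∈ T, (ProbabilityTheory.cond (m i) (A i)) (t i)
      = ∏ i ∈ S ∪ T, (ProbabilityTheory.cond (m i) (A i)) (t' i) := by
    rw [← Finset.prod_subset (Finset.subset_union_right : T ⊆ S ∪ T)]
    · exact Finset.prod_congr rfl fun i hi => by simp [ht', hi]
    · intro i _ hi; simp [ht', hi]
  rw [h3, Finset.prod_congr rfl fun i _ => ProbabilityTheory.cond_apply (hA i) (m i) (t' i),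
    Finset.prod_mul_distrib, ENNReal.prod_inv_distrib]
  intro i _ j _ _
  exact Or.inr (measure_ne_top _ _)

end Product

/-! ### The law of a single vertex -/

section SiteLaw

instance : Finite Colour :=
  Finite.of_surjective (fun i : Fin 3 => ![Colour.empty, Colour.blue, Colour.red] i)
    fun c => by
      cases c
      · exact ⟨0, rfl⟩
      · exact ⟨1, rfl⟩
      · exact ⟨2, rfl⟩

instance : MeasurableSingletonClass Colour := ⟨fun _ => trivial⟩

/-- The law of the initial colour and the coin of one vertex. -/
noncomputable def siteLaw (p q : ℝ) : Measure (Colour × Bool) := (colourLaw p q).prod coinLaw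

theorem law_eq (p q : ℝ) : law p q = Measure.infinitePi fun _ => siteLaw p q := rfl

variable {p q : ℝ}

theorem isProbabilityMeasure_siteLaw (hp : 0 ≤ p) (hq : 0 ≤ q) (hpq : p + q ≤ 1) :
    IsProbabilityMeasure (siteLaw p q) := by
  have := isProbabilityMeasure_colourLaw hp hq hpq
  have := isProbabilityMeasure_coinLaw
  unfold siteLaw
  infer_instance

theorem siteLaw_fst (A : Set Colour) : siteLaw p q {s | s.1 ∈ A} = colourLaw p q A := by
  have := isProbabilityMeasure_coinLaw
  have h : {s : Colour × Bool | s.1 ∈ A} = A ×ˢ Set.univ := by ext; simp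
  rw [siteLaw, h, Measure.prod_prod, measure_univ, mul_one]

theorem siteLaw_blue : siteLaw p q {s | s.1 = Colour.blue} = ENNReal.ofReal p := by
  have := siteLaw_fst (p := p) (q := q) {Colour.blue}
  simp only [Set.mem_singleton_iff] at this
  rw [this]; simp [colourLaw]

theorem siteLaw_red : siteLaw p q {s | s.1 = Colour.red} = ENNReal.ofReal q := by
  have := siteLaw_fst (p := p) (q := q) {Colour.red}
  simp only [Set.mem_singleton_iff] at this
  rw [this]; simp [colourLaw]

theorem siteLaw_empty : siteLaw p q {s | s.1 = Colour.empty} = ENNReal.ofReal (1 - p - q) := by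
  have := siteLaw_fst (p := p) (q := q) {Colour.empty}
  simp only [Set.mem_singleton_iff] at this
  rw [this]; simp [colourLaw]

theorem siteLaw_ne_red (hp : 0 ≤ p) (hq : 0 ≤ q) (hpq : p + q ≤ 1) :
    siteLaw p q {s | s.1 ≠ Colour.red} = ENNReal.ofReal (1 - q) := by
  have := isProbabilityMeasure_siteLaw hp hq hpq
  have h : {s : Colour × Bool | s.1 ≠ Colour.red} = {s | s.1 = Colour.red}ᶜ := rfl
  rw [h, prob_compl_eq_one_sub (Set.toFinite _).measurableSet, siteLaw_red,
    ENNReal.ofReal_sub _ hq, ENNReal.ofReal_one]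

end SiteLaw

/-! ### Almost sure colouring of every vertex -/

section EventuallyNonempty

variable {r : ℝ} {B : Set (ℤ × ℤ)} {ω : Sample}

/-- If the right neighbour ever had a colour, the next update of that colour would fill the vertex,
since `(1, 0)` lies in both neighbourhoods. Induction carries emptiness along the half-line. -/
theorem initial_empty_of_not_eventuallyNonempty (hr : 0 < r) {ρ : ℕ} (hρ : 1 ≤ ρ)
    (hB : ((1, 0) : ℤ × ℤ) ∈ B) {x : ℤ × ℤ} (hx : ¬ EventuallyNonempty r B (l1Ball ρ) ω x)
    (k : ℕ) : ¬ EventuallyNonempty r B (l1Ball ρ) ω (x + ((k : ℤ), 0)) := by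
  induction k with
  | zero => rwa [show ((((0 : ℕ) : ℤ), (0 : ℤ)) : ℤ × ℤ) = 0 from rfl, add_zero]
  | succ k ih =>
    rintro ⟨n, hn⟩
    apply ih
    have he : x + (((k + 1 : ℕ) : ℤ), 0) = (x + ((k : ℤ), 0)) + ((1, 0) : ℤ × ℤ) := by
      ext <;> simp; ring
    rw [he] at hn
    by_cases hb : config r B (l1Ball ρ) ω n (x + ((k : ℤ), 0) + ((1, 0) : ℤ × ℤ)) = Colour.blue
    · obtain ⟨m, hm, ht⟩ := exists_isBlueTime hr n
      exact ⟨m + 1, ne_empty_of_blue ht hB (config_eq_of_le hm hb (by simp))⟩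
    · obtain ⟨m, hm, ht⟩ := exists_isRedTime hr n
      refine ⟨m + 1, ne_empty_of_red ht (d := (1, 0)) ?_
        (config_eq_of_le hm (eq_red_of_ne hn hb) (by simp))⟩
      simp only [l1Ball, Set.mem_ofPred_eq]
      simpa using hρ

/-- If blue spreads to the left, every vertex is almost surely coloured eventually. -/
theorem ae_eventuallyNonempty (hr : 0 < r) {ρ : ℕ} (hρ : 1 ≤ ρ)
    (hB : ((1, 0) : ℤ × ℤ) ∈ B) {p q : ℝ} (hp : 0 ≤ p) (hq : 0 ≤ q) (hpq : p + q ≤ 1)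
    (h0 : ¬ (p = 0 ∧ q = 0)) :
    ∀ᵐ ω ∂(law p q), ∀ x : ℤ × ℤ, EventuallyNonempty r B (l1Ball ρ) ω x := by
  rw [ae_all_iff]
  intro x
  have := isProbabilityMeasure_siteLaw hp hq hpq
  have hlt : ENNReal.ofReal (1 - p - q) < 1 := by
    rw [← ENNReal.ofReal_one, ENNReal.ofReal_lt_ofReal_iff one_pos]
    rcases hp.eq_or_lt with h | h
    · rcases hq.eq_or_lt with h' | h'
      · exact absurd ⟨h.symm, h'.symm⟩ h0
      · linarith
    · linarith
  rw [ae_iff]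
  refine le_antisymm ?_ zero_le
  refine ge_of_tendsto' (ENNReal.tendsto_pow_atTop_nhds_zero_of_lt_one hlt) fun n => ?_
  let f : ℕ ↪ ℤ × ℤ := ⟨fun k => x + ((k : ℤ), 0), fun a b h => by simpa using h⟩
  calc law p q {ω | ¬ EventuallyNonempty r B (l1Ball ρ) ω x}
      ≤ law p q (Set.pi ((Finset.range n).map f : Finset (ℤ × ℤ))
          fun _ => {s | s.1 = Colour.empty}) := by
        refine measure_mono fun ω hω => ?_
        simp only [Set.mem_pi, Finset.mem_coe, Finset.mem_map, Finset.mem_range,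
          forall_exists_index, and_imp, forall_apply_eq_imp_iff₂, Set.mem_ofPred_eq]
        intro k _
        have h := initial_empty_of_not_eventuallyNonempty hr hρ hB hω k
        by_contra hc
        exact h ⟨0, hc⟩
    _ = ENNReal.ofReal (1 - p - q) ^ n := by
        rw [law_eq, Measure.infinitePi_pi _ fun _ _ => (Set.toFinite _).measurableSet]
        simp [siteLaw_empty]

end EventuallyNonempty

/-! ### Red descends a column and then takes row 0 -/

section RedPath

variable {r : ℝ} {ω : Sample}

/-- Until the red clock exceeds `k`, blue has made at most `r * (k + 1)` updates and has moved at
most `E` within the row. -/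
theorem ne_blue_of_no_initial_blue (hr : 0 < r) {τ ρ k E : ℕ} {u : ℤ × ℤ}
    (hE : (τ : ℝ) * (r * (k + 1)) ≤ E)
    (h : ∀ z : ℤ, |z - u.1| ≤ E → (ω (z, u.2)).1 ≠ Colour.blue) {n : ℕ}
    (hn : redCount r n ≤ k) : config r (segment τ) (l1Ball ρ) ω n u ≠ Colour.blue := by
  intro hb
  obtain ⟨z, hz, hd⟩ := exists_initial_blue hr hb
  refine h z (hd.trans ?_) hz
  have h1 : (blueCount r n : ℝ) ≤ r * (k + 1) :=
    (blueCount_le_mul hr n).trans (by gcongr)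
  have h2 : (τ : ℝ) * blueCount r n ≤ E := (by gcongr : _ ≤ (τ : ℝ) * (r * (k + 1))).trans hE
  exact_mod_cast h2

/-- A red vertex at `(x, y)` reaches the origin before blue if row `0` has no blue vertex nearby
and near the column of `x` no `ρ` consecutive rows below height `y` all hold a blue vertex. -/
theorem not_eventuallyBlue_of_red (hr : 0 < r) {τ ρ x y D E : ℕ} (hρ : 1 ≤ ρ)
    (hv : (ω ((x : ℤ), (y : ℤ))).1 = Colour.red)
    (hrow : ∀ z : ℤ, |z| ≤ D → (ω (z, 0)).1 ≠ Colour.blue)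
    (hcol : ∀ y₀ : ℕ, 1 ≤ y₀ → y₀ + ρ ≤ y → ∃ j < ρ, ∀ z : ℤ, |z - x| ≤ E →
      (ω (z, ((y₀ + j : ℕ) : ℤ))).1 ≠ Colour.blue)
    (hE : (τ : ℝ) * (r * (y + 1)) ≤ E) (hD : (x : ℝ) + τ * (r * (y + x + 1)) ≤ D) :
    ¬ EventuallyBlue r (segment τ) (l1Ball ρ) ω (0, 0) := by
  set c := config r (segment τ) (l1Ball ρ) ω with hc
  -- The whole journey takes at most `y + x` red updates. The window of radius `D - x` around any `i
  -- ≤ x` lies in `[-D, D]`.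
  have hnb0 : ∀ i ≤ x, ∀ k ≤ y + x, ∀ n, redCount r n ≤ k → c n ((i : ℤ), 0) ≠ Colour.blue := by
    intro i hi k hk n hn
    have hxD : x ≤ D := by
      have : (x : ℝ) ≤ D := le_trans (le_add_of_nonneg_right (by positivity)) hD
      exact_mod_cast this
    refine ne_blue_of_no_initial_blue (E := D - x) hr ?_ (fun z hz => hrow z ?_) hn
    · rw [Nat.cast_sub hxD]
      have : (k : ℝ) ≤ y + x := by exact_mod_cast hk
      have : (τ : ℝ) * (r * (k + 1)) ≤ τ * (r * (y + x + 1)) := by gcongr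
      linarith
    · rw [Nat.cast_sub hxD] at hz
      simp only at hz
      rw [abs_le] at hz ⊢
      omega
  -- Each red update lowers red by at least one row, so height `y'` is reached by red time `y - y'`.
  -- Above height `ρ`, one of the next `ρ` rows is free of blue nearby and red jumps there; from
  -- height at most `ρ` it jumps straight to row 0.
  have hdesc : ∀ y' ≤ y, (∀ n, y - y' ≤ redCount r n → c n ((x : ℤ), (y' : ℤ)) = Colour.red) →
      ∀ n, y ≤ redCount r n → c n ((x : ℤ), 0) = Colour.red := by
    intro y'
    induction y' using Nat.strong_induction_on with
    | _ y' ih =>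
      intro hy' hre
      rcases Nat.eq_zero_or_pos y' with h0 | hpos
      · subst h0; simpa using hre
      rcases le_or_gt y' ρ with hle | hgt
      · intro n hn
        refine red_step hr (k := y - y') (k' := y) (by omega) hre ?_
          (hnb0 x le_rfl y (by omega)) hn
        simpa using hle
      · obtain ⟨j, hj, hz⟩ := hcol (y' - ρ) (by omega) (by omega)
        refine ih (y' - ρ + j) (by omega) (by omega) fun n hn => ?_
        refine red_step hr (k := y - y') (k' := y - (y' - ρ + j)) (by omega) hre ?_ ?_ hn
        · simp only [sub_self, abs_zero, zero_add]
          rw [abs_le]; omega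
        · refine fun n hn => ne_blue_of_no_initial_blue (E := E) hr (le_trans ?_ hE) hz hn
          gcongr
          omega
  have h0 : ∀ n, y ≤ redCount r n → c n ((x : ℤ), 0) = Colour.red :=
    hdesc y le_rfl fun n _ => config_eq_of_le (Nat.zero_le n) hv (by simp)
  have hrow' : ∀ i ≤ x, ∀ n, y + i ≤ redCount r n → c n (((x - i : ℕ) : ℤ), 0) = Colour.red := by
    intro i
    induction i with
    | zero => intro _; simpa using h0
    | succ i ih =>
      intro hi n hn
      refine red_step hr (k := y + i) (k' := y + (i + 1)) (by omega) (ih (by omega)) ?_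
        (hnb0 _ (by omega) _ (by omega)) hn
      simp only [sub_self, abs_zero, add_zero]
      rw [abs_le]; omega
  rintro ⟨n, hn⟩
  obtain ⟨l, hl⟩ := exists_le_redCount hr (y + x)
  have h1 := hrow' x le_rfl (max n l) (hl.trans (redCount_mono hr (le_max_right _ _)))
  have h2 := config_eq_of_le (le_max_left n l) hn (by simp)
  simp only [Nat.sub_self, Nat.cast_zero] at h1
  rw [hc] at h1
  rw [h1] at h2
  exact absurd h2 (by simp)

end RedPath

/-! ### Upper bound for the probability that blue wins -/

section RedWins

theorem infinitePi_real_pi {ι X : Type*} [MeasurableSpace X] {m : ι → Measure X}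
    [∀ i, IsProbabilityMeasure (m i)] {S : Finset ι} {t : ι → Set X}
    (ht : ∀ i ∈ S, MeasurableSet (t i)) :
    (Measure.infinitePi m).real (Set.pi S t) = ∏ i ∈ S, (m i).real (t i) := by
  rw [measureReal_def, Measure.infinitePi_pi _ ht, ENNReal.toReal_prod]
  rfl

theorem siteLaw_real_blue {p q : ℝ} (hp : 0 ≤ p) :
    (siteLaw p q).real {s | s.1 = Colour.blue} = p := by
  rw [measureReal_def, siteLaw_blue, ENNReal.toReal_ofReal hp]

theorem siteLaw_real_red {p q : ℝ} (hq : 0 ≤ q) :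
    (siteLaw p q).real {s | s.1 = Colour.red} = q := by
  rw [measureReal_def, siteLaw_red, ENNReal.toReal_ofReal hq]

theorem siteLaw_real_ne_red {p q : ℝ} (hp : 0 ≤ p) (hq : 0 ≤ q) (hpq : p + q ≤ 1) :
    (siteLaw p q).real {s | s.1 ≠ Colour.red} = 1 - q := by
  rw [measureReal_def, siteLaw_ne_red hp hq hpq, ENNReal.toReal_ofReal (by linarith)]

/-- Union bound for the absence of obstacles on the way of a red vertex at `(x, y)`. -/
theorem prob_obstacle_le {m : ℤ × ℤ → Measure (Colour × Bool)} [∀ i, IsProbabilityMeasure (m i)]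
    {p : ℝ} {ρ x y D E : ℕ} (hy : 1 ≤ y)
    (hm : ∀ s : ℤ × ℤ, s.2 < y → (m s).real {s | s.1 = Colour.blue} = p) :
    (Measure.infinitePi m).real {ω | ¬ ((∀ z : ℤ, |z| ≤ D → (ω (z, 0)).1 ≠ Colour.blue) ∧
      ∀ y₀ : ℕ, 1 ≤ y₀ → y₀ + ρ ≤ y → ∃ j < ρ, ∀ z : ℤ, |z - x| ≤ E →
      (ω (z, ((y₀ + j : ℕ) : ℤ))).1 ≠ Colour.blue)} ≤
    (2 * D + 1) * p + y * ((2 * E + 1) * p) ^ ρ := by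
  classical
  set μ := Measure.infinitePi m
  set rowEv : ℤ → Set Sample := fun z => Set.pi ({(z, 0)} : Finset (ℤ × ℤ))
    fun _ => {s | s.1 = Colour.blue}
  -- An obstacle is witnessed by one blue vertex in each of `ρ` consecutive rows. The map `f`
  -- records the abscissae, and the union bound over `f` gives `((2 * E + 1) * p) ^ ρ`.
  set g : ℕ → (Fin ρ → ℤ) → (Fin ρ ↪ ℤ × ℤ) := fun y₀ f =>
    ⟨fun j => (f j, ((y₀ + j : ℕ) : ℤ)), fun a b h => by
      have := (Prod.mk.inj h).2
      apply Fin.ext; omega⟩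
  set colEv : ℕ → (Fin ρ → ℤ) → Set Sample := fun y₀ f =>
    Set.pi (Finset.univ.map (g y₀ f) : Finset (ℤ × ℤ)) fun _ => {s | s.1 = Colour.blue}
  set Y := (Finset.Icc 1 y).filter fun y₀ => y₀ + ρ ≤ y
  set F : Finset (Fin ρ → ℤ) := Fintype.piFinset fun _ => Finset.Icc ((x : ℤ) - E) (x + E)
  have hsub : {ω : Sample | ¬ ((∀ z : ℤ, |z| ≤ D → (ω (z, 0)).1 ≠ Colour.blue) ∧
      ∀ y₀ : ℕ, 1 ≤ y₀ → y₀ + ρ ≤ y → ∃ j < ρ, ∀ z : ℤ, |z - x| ≤ E →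
      (ω (z, ((y₀ + j : ℕ) : ℤ))).1 ≠ Colour.blue)} ⊆
      (⋃ z ∈ Finset.Icc (-(D : ℤ)) D, rowEv z) ∪ ⋃ y₀ ∈ Y, ⋃ f ∈ F, colEv y₀ f := by
    intro ω hω
    rw [Set.mem_ofPred_eq, not_and_or] at hω
    rcases hω with h | h
    · left
      push Not at h
      obtain ⟨z, hz, hb⟩ := h
      simp only [Set.mem_iUnion]
      exact ⟨z, Finset.mem_Icc.2 (abs_le.1 hz), by simpa [rowEv] using hb⟩
    · right
      push Not at h
      obtain ⟨y₀, h1, h2, h3⟩ := h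
      choose! f hf1 hf2 using h3
      simp only [Set.mem_iUnion]
      refine ⟨y₀, by simp [Y]; omega, fun j => f j, ?_, ?_⟩
      · simp only [F, Fintype.mem_piFinset, Finset.mem_Icc]
        intro j
        have := abs_le.1 (hf1 j j.2)
        omega
      · simp only [colEv, Set.mem_pi, Finset.mem_coe, Finset.mem_map, Finset.mem_univ, true_and,
          forall_exists_index, forall_apply_eq_imp_iff]
        intro j
        exact hf2 j j.2
  have hrow : ∀ z, μ.real (rowEv z) = p := fun z => by
    rw [infinitePi_real_pi fun _ _ => (Set.toFinite _).measurableSet]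
    simpa using hm (z, 0) (show (0 : ℤ) < y by exact_mod_cast hy)
  have hcol : ∀ y₀ ∈ Y, ∀ f, μ.real (colEv y₀ f) = p ^ ρ := fun y₀ hy₀ f => by
    rw [infinitePi_real_pi fun _ _ => (Set.toFinite _).measurableSet]
    rw [Finset.prod_map, Finset.prod_congr rfl fun j _ => hm (g y₀ f j) ?_]
    · simp
    · simp only [Y, Finset.mem_filter] at hy₀
      have := j.2
      change ((y₀ + j : ℕ) : ℤ) < y
      omega
  have hp : 0 ≤ p := by rw [← hm (0, 0) (show (0 : ℤ) < y by exact_mod_cast hy)]; exact measureReal_nonneg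
  calc _ ≤ μ.real (_ ∪ _) := measureReal_mono hsub
    _ ≤ _ := measureReal_union_le _ _
    _ ≤ (∑ z ∈ Finset.Icc (-(D : ℤ)) D, p) + ∑ y₀ ∈ Y, ∑ f ∈ F, p ^ ρ := by
        refine add_le_add ?_ ?_
        · exact (measureReal_biUnion_finset_le _ _).trans_eq (Finset.sum_congr rfl fun z _ => hrow z)
        · refine (measureReal_biUnion_finset_le _ _).trans (Finset.sum_le_sum fun y₀ hy₀ => ?_)
          exact (measureReal_biUnion_finset_le _ _).trans_eq
            (Finset.sum_congr rfl fun f _ => hcol y₀ hy₀ f)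
    _ ≤ _ := by
        refine add_le_add (le_of_eq ?_) ?_
        · rw [Finset.sum_const, Int.card_Icc, nsmul_eq_mul]
          rw [show ((D : ℤ) + 1 - -(D : ℤ)).toNat = 2 * D + 1 by omega]
          push_cast; ring
        · have hF : (F.card : ℝ) = (2 * E + 1) ^ ρ := by
            rw [Fintype.card_piFinset_const, Int.card_Icc,
              show ((x : ℤ) + E + 1 - ((x : ℤ) - E)).toNat = 2 * E + 1 by omega]
            simp
          have hY : (Y.card : ℝ) ≤ y := by
            have := Finset.card_filter_le (Finset.Icc 1 y) fun y₀ => y₀ + ρ ≤ y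
            rw [Nat.card_Icc] at this
            exact_mod_cast this
          rw [Finset.sum_const, Finset.sum_const, nsmul_eq_mul, nsmul_eq_mul, hF, ← mul_pow]
          gcongr

/-- If the `W × M` box to the right of and above the origin holds a red vertex, then red is likely
to beat blue at the origin. -/
theorem probBlue_le (r : ℝ) (hr : 0 < r) {p q : ℝ} (hp : 0 ≤ p) (hq : 0 < q) (hq1 : q < 1)
    (hpq : p + q ≤ 1) {τ ρ W M D E : ℕ} (hρ : 1 ≤ ρ)
    (hE : (τ : ℝ) * (r * (M + 1)) ≤ E) (hD : (W : ℝ) + τ * (r * (M + W + 1)) ≤ D) :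
    probBlue r (segment τ) (l1Ball ρ) p q ≤
      1 - (1 - (1 - q) ^ (W * M)) * (1 - ((2 * D + 1) * p + M * ((2 * E + 1) * p) ^ ρ)) := by
  classical
  have hsite := isProbabilityMeasure_siteLaw hp hq.le hpq
  have hlaw := isProbabilityMeasure_law hp hq.le hpq
  set μ := law p q with hμ
  set ε := (2 * D + 1) * p + M * ((2 * E + 1) * p) ^ ρ with hε
  set ι : ℕ × ℕ ↪ ℤ × ℤ := ⟨fun v => ((v.1 : ℤ), (v.2 : ℤ)), fun a b h => by
    obtain ⟨h1, h2⟩ := Prod.mk.inj h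
    exact Prod.ext (by exact_mod_cast h1) (by exact_mod_cast h2)⟩ with hι
  set V : Finset (ℕ × ℕ) := Finset.range W ×ˢ Finset.Icc 1 M with hV
  -- The box is explored from the top row down, each row from left to right. The event that `v` is
  -- the first red vertex involves only heights at least `v.2`, while the obstacles for `v` live
  -- strictly below.
  set before : ℕ × ℕ → Finset (ℕ × ℕ) := fun v =>
    V.filter fun u => v.2 < u.2 ∨ (u.2 = v.2 ∧ u.1 < v.1) with hbefore
  set A : ℕ × ℕ → ℤ × ℤ → Set (Colour × Bool) := fun v s =>
    if s = ι v then {s | s.1 = Colour.red}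
    else if s ∈ (before v).map ι then {s | s.1 ≠ Colour.red} else Set.univ with hA
  set S : ℕ × ℕ → Finset (ℤ × ℤ) := fun v => (insert v (before v)).map ι with hS
  set G : ℕ × ℕ → Set Sample := fun v =>
    {ω | ((∀ z : ℤ, |z| ≤ D → (ω (z, 0)).1 ≠ Colour.blue) ∧
      ∀ y₀ : ℕ, 1 ≤ y₀ → y₀ + ρ ≤ v.2 → ∃ j < ρ, ∀ z : ℤ, |z - v.1| ≤ E →
      (ω (z, ((y₀ + j : ℕ) : ℤ))).1 ≠ Colour.blue)} with hG
  have hAm : ∀ v s, MeasurableSet (A v s) := fun _ _ => (Set.toFinite _).measurableSet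
  have hpiA : ∀ v (ω : Sample), ω ∈ Set.pi (S v) (A v) ↔
      (ω (ι v)).1 = Colour.red ∧ ∀ u ∈ before v, (ω (ι u)).1 ≠ Colour.red := by
    intro v ω
    have hne : ∀ u ∈ before v, u ≠ v := by
      rintro u hu rfl
      simp [hbefore] at hu
    simp only [hS, Finset.coe_map, Set.mem_pi, Set.forall_mem_image, Finset.mem_coe,
      Finset.mem_insert, forall_eq_or_imp]
    refine and_congr (by simp [hA]) (forall₂_congr fun u hu => ?_)
    have h1 : ι u ≠ ι v := fun h => hne u hu (ι.injective h)
    have h2 : ι u ∈ (before v).map ι := Finset.mem_map_of_mem _ hu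
    simp only [hA, if_neg h1, if_pos h2]
    rfl
  have hdisj : ∀ v ∈ V, ∀ w ∈ V, v ≠ w → Disjoint (Set.pi (S v) (A v)) (Set.pi (S w) (A w)) := by
    intro v hv w hw hvw
    rw [Set.disjoint_left]
    intro ω h1 h2
    rw [hpiA] at h1 h2
    have : w ∈ before v ∨ v ∈ before w := by
      simp only [hbefore, Finset.mem_filter, hv, hw, true_and]
      have : v.1 ≠ w.1 ∨ v.2 ≠ w.2 := by
        by_contra! h; exact hvw (Prod.ext h.1 h.2)
      omega
    rcases this with h | h
    · exact h1.2 w h h2.1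
    · exact h2.2 v h h1.1
  have hpm : ∀ v, MeasurableSet (Set.pi (S v) (A v)) := fun v =>
    MeasurableSet.pi (Finset.countable_toSet _) fun s _ => hAm v s
  have hunion : (⋃ v ∈ V, Set.pi (S v) (A v) : Set Sample) =
      (Set.pi (V.map ι : Finset (ℤ × ℤ)) fun _ => {s | s.1 ≠ Colour.red})ᶜ := by
    ext ω
    simp only [Set.mem_iUnion, hpiA, Set.mem_compl_iff, Set.mem_pi, Finset.mem_coe,
      Finset.mem_map, forall_exists_index, and_imp, forall_apply_eq_imp_iff₂, exists_prop]
    constructor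
    · rintro ⟨v, hv, h, _⟩ hall
      exact hall v hv h
    · intro h
      simp only [not_forall, Set.mem_ofPred_eq, not_not, exists_prop] at h
      obtain ⟨v₀, hv₀, h₀⟩ := h
      -- The first red vertex in this order maximises the height, then minimises the abscissa.
      obtain ⟨v, hv, hmax⟩ := Finset.exists_max_image
        (V.filter fun v => (ω (ι v)).1 = Colour.red)
        (fun v => (toLex ((v.2 : ℤ), -(v.1 : ℤ)) : ℤ ×ₗ ℤ)) ⟨v₀, by simp [hv₀, h₀]⟩
      rw [Finset.mem_filter] at hv
      refine ⟨v, hv.1, hv.2, fun u hu hr' => ?_⟩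
      simp only [hbefore, Finset.mem_filter] at hu
      have h1 := hmax u (by simp [hu.1, hr'])
      rw [Prod.Lex.toLex_le_toLex] at h1
      simp only at h1
      omega
  have hred : ∑ v ∈ V, μ.real (Set.pi (S v) (A v)) = 1 - (1 - q) ^ (W * M) := by
    rw [← measureReal_biUnion_finset (fun v hv w hw hvw => hdisj v hv w hw hvw)
      (fun v _ => hpm v), hunion, probReal_compl_eq_one_sub
        (MeasurableSet.pi (Finset.countable_toSet _) fun s _ => (Set.toFinite _).measurableSet),
      hμ, law_eq, infinitePi_real_pi fun _ _ => (Set.toFinite _).measurableSet]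
    simp [siteLaw_real_ne_red hp hq.le hpq, hV]
  have hgood : ∀ v ∈ V, μ.real (Set.pi (S v) (A v)) * (1 - ε) ≤
      μ.real (Set.pi (S v) (A v) ∩ G v) := by
    intro v hv
    simp only [hV, Finset.mem_product, Finset.mem_range, Finset.mem_Icc] at hv
    have h0 : ∀ s, siteLaw p q (A v s) ≠ 0 := by
      intro s
      simp only [hA]
      split_ifs
      · rw [siteLaw_red]; simpa using hq
      · rw [siteLaw_ne_red hp hq.le hpq]; simpa using hq1
      · simp
    have hcond := cond_infinitePi (m := fun _ => siteLaw p q) (S := S v) (A := A v) (hAm v)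
      (fun s hs => by
        simp only [hS, Finset.map_insert, Finset.mem_insert, not_or] at hs
        simp only [hA, if_neg hs.1, if_neg hs.2]) h0
    have : ∀ s, IsProbabilityMeasure (ProbabilityTheory.cond (siteLaw p q) (A v s)) :=
      fun s => ProbabilityTheory.cond_isProbabilityMeasure (h0 s)
    -- Conditioning on `v` being the first red vertex leaves the factors below row `v.2` unchanged,
    -- so the blue density there is still `p`.
    have hob := prob_obstacle_le (m := fun s => ProbabilityTheory.cond (siteLaw p q) (A v s))
      (p := p) (ρ := ρ) (x := v.1) (y := v.2) (D := D) (E := E) hv.2.1 (fun s hs => by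
        have : A v s = Set.univ := by
          simp only [hA]
          rw [if_neg, if_neg]
          · simp only [hbefore, Finset.mem_map, Finset.mem_filter, not_exists, not_and]
            rintro u ⟨_, hu⟩ rfl
            have hs' : ((u.2 : ℕ) : ℤ) < v.2 := hs
            omega
          · rintro rfl
            exact lt_irrefl _ hs
        rw [this, ProbabilityTheory.cond_univ, siteLaw_real_blue hp])
    rw [← hcond] at hob
    have hcp : IsProbabilityMeasure (ProbabilityTheory.cond μ (Set.pi (S v) (A v))) := by
      rw [hμ, law_eq, hcond]; infer_instance
    have hGm : (ProbabilityTheory.cond μ (Set.pi (S v) (A v))).real (G v) ≥ 1 - ε := by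
      have h1 : 1 ≤ (ProbabilityTheory.cond μ (Set.pi (S v) (A v))).real (G v) +
          (ProbabilityTheory.cond μ (Set.pi (S v) (A v))).real (G v)ᶜ := by
        have h2 := measureReal_union_le (μ := ProbabilityTheory.cond μ (Set.pi (S v) (A v)))
          (G v) (G v)ᶜ
        rwa [Set.union_compl_self, probReal_univ] at h2
      have h3 : (ProbabilityTheory.cond μ (Set.pi (S v) (A v))).real (G v)ᶜ ≤ ε := by
        refine hob.trans ?_
        have : (v.2 : ℝ) ≤ M := by exact_mod_cast hv.2.2
        rw [hε]
        gcongr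
      linarith
    have h4 : μ.real (Set.pi (S v) (A v) ∩ G v) = μ.real (Set.pi (S v) (A v)) *
        (ProbabilityTheory.cond μ (Set.pi (S v) (A v))).real (G v) := by
      rw [mul_comm, measureReal_def, measureReal_def, measureReal_def, ← ENNReal.toReal_mul,
        ProbabilityTheory.cond_mul_eq_inter (hpm v)]
    rw [h4]
    gcongr
  have hGmeas : ∀ v, MeasurableSet (G v) := by
    intro v
    refine measurableSet_of_dependsOn (S := (Finset.Icc (-(D : ℤ)) D ∪
      Finset.Icc ((v.1 : ℤ) - E) (v.1 + E)) ×ˢ Finset.Icc 0 ((v.2 : ℤ))) fun ω ω' h => ?_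
    simp only [hG, Set.mem_ofPred_eq, eq_iff_iff]
    refine and_congr (forall₂_congr fun z hz => ?_) (forall₃_congr fun y₀ h1 h2 =>
      exists_congr fun j => and_congr_right fun hj => forall₂_congr fun z hz => ?_)
    · rw [h]
      rw [abs_le] at hz
      simp; omega
    · rw [h]
      rw [abs_le] at hz
      simp; omega
  have hsub : {ω | EventuallyBlue r (segment τ) (l1Ball ρ) ω (0, 0)} ⊆
      (⋃ v ∈ V, (Set.pi (S v) (A v) ∩ G v) : Set Sample)ᶜ := by
    intro ω hω
    simp only [Set.mem_compl_iff, Set.mem_iUnion, not_exists]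
    rintro v hv ⟨h1, h2⟩
    simp only [hV, Finset.mem_product, Finset.mem_range, Finset.mem_Icc] at hv
    rw [hpiA] at h1
    have hy : (v.2 : ℝ) ≤ M := by exact_mod_cast hv.2.2
    have hx : (v.1 : ℝ) ≤ W := by exact_mod_cast hv.1.le
    refine not_eventuallyBlue_of_red hr hρ h1.1 h2.1 h2.2 (hE.trans' ?_) (hD.trans' ?_) hω
    · gcongr
    · gcongr
  have hpgm : ∀ v ∈ V, MeasurableSet (Set.pi (S v) (A v) ∩ G v) := fun v _ =>
    (hpm v).inter (hGmeas v)
  calc probBlue r (segment τ) (l1Ball ρ) p q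
      ≤ μ.real (⋃ v ∈ V, (Set.pi (S v) (A v) ∩ G v) : Set Sample)ᶜ := measureReal_mono hsub
    _ = 1 - ∑ v ∈ V, μ.real (Set.pi (S v) (A v) ∩ G v) := by
        rw [probReal_compl_eq_one_sub (Finset.measurableSet_biUnion _ hpgm),
          measureReal_biUnion_finset (fun v hv w hw hvw =>
            (hdisj v hv w hw hvw).mono Set.inter_subset_left Set.inter_subset_left) hpgm]
    _ ≤ _ := by
        have := Finset.sum_le_sum hgood
        rw [← Finset.sum_mul, hred] at this
        linarith

end RedWins

/-! ### Scaling limit of the upper bound -/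

section Scaling

/-- The scaling `p = h ^ (ρ + 1)`, under which all the relevant lengths are powers of `h`. -/
theorem eventually_exists_scale (ρ : ℕ) {h₀ : ℝ} (h₀pos : 0 < h₀) :
    ∀ᶠ p : ℝ in 𝓝[>] 0, ∃ h : ℝ, 0 < h ∧ h ≤ h₀ ∧ p = h ^ (ρ + 1) ∧
      p ^ (1 + (ρ : ℝ) / ((ρ : ℝ) + 1)) = h ^ (2 * ρ + 1) := by
  have h1 : Set.Ioc (0 : ℝ) (h₀ ^ (ρ + 1)) ∈ 𝓝[>] (0 : ℝ) := Ioc_mem_nhdsGT (by positivity)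
  filter_upwards [h1] with p hp
  have hne : (ρ : ℝ) + 1 ≠ 0 := by positivity
  have h2 : p = (p ^ (1 / ((ρ : ℝ) + 1))) ^ (ρ + 1) := by
    rw [← Real.rpow_natCast, ← Real.rpow_mul hp.1.le]
    push_cast
    rw [one_div, inv_mul_cancel₀ hne, Real.rpow_one]
  refine ⟨p ^ (1 / ((ρ : ℝ) + 1)), Real.rpow_pos_of_pos hp.1 _, ?_, h2, ?_⟩
  · refine le_of_pow_le_pow_left₀ (n := ρ + 1) (by omega) h₀pos.le ?_
    rw [← h2]
    exact hp.2
  · rw [← Real.rpow_natCast, ← Real.rpow_mul hp.1.le]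
    congr 1
    push_cast
    field_simp
    ring

/-- The box has width `s / p` and height `s / h ^ ρ`, up to rounding, so the expected number of its
red vertices is about `a * s ^ 2`. As `C` depends on neither `s` nor `a`, one may fix a small `s`
and then let `a` grow. -/
theorem exists_probBlue_le (r : ℝ) (hr : 0 < r) (τ ρ : ℕ) (hρ : 1 ≤ ρ) :
    ∃ C : ℝ, 0 < C ∧ ∀ s : ℝ, 0 < s → s ≤ 1 → C * s ≤ 1 → ∀ a : ℝ, 0 < a →
      ∀ᶠ p : ℝ in 𝓝[>] 0, probBlue r (segment τ) (l1Ball ρ) p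
          (a * p ^ (1 + (ρ : ℝ) / ((ρ : ℝ) + 1))) ≤
        1 - (1 - Real.exp (-(a * s ^ 2))) * (1 - C * s) := by
  set κ : ℝ := τ * r with hκ
  have hκ0 : 0 ≤ κ := by positivity
  -- The term `7 + 10 * κ` pays for blue in row 0 (`h2`), the other for runs of `ρ` rows (`h3`).
  refine ⟨7 + 10 * κ + (4 * κ + 3) ^ ρ * 2 ^ (ρ + 1), by positivity, fun s hs hs1 hCs a ha => ?_⟩
  -- The first bound absorbs the ceilings into factors 2; the second keeps `q` below `1 / 2`.
  have hh0 : 0 < min (s / 2) (1 / (2 * a + 2)) := by positivity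
  filter_upwards [eventually_exists_scale ρ hh0] with p hp
  obtain ⟨h, hpos, hle, rfl, hq⟩ := hp
  rw [hq]
  have hs2 : h ≤ s / 2 := hle.trans (min_le_left _ _)
  have ha2 : h ≤ 1 / (2 * a + 2) := hle.trans (min_le_right _ _)
  have hh1 : h ≤ 1 := by linarith
  have hhalf : h ≤ 1 / 2 := by linarith
  have hah : a * h < 1 / 2 := by
    rw [le_div_iff₀ (by positivity)] at ha2
    nlinarith
  have hpow : ∀ k, 1 ≤ k → h ^ k ≤ h := fun k hk => pow_le_of_le_one hpos.le hh1 (by omega)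
  have hpρ : h ^ ρ ≤ s := (hpow ρ hρ).trans (by linarith)
  have hps : h ^ (ρ + 1) ≤ s := (hpow _ (by omega)).trans (by linarith)
  have hqlt : a * h ^ (2 * ρ + 1) < 1 / 2 :=
    lt_of_le_of_lt (mul_le_mul_of_nonneg_left (hpow _ (by omega)) ha.le) hah
  have hp2 : h ^ (ρ + 1) ≤ 1 / 2 := (hpow _ (by omega)).trans hhalf
  have hp0 : 0 < h ^ (ρ + 1) := by positivity
  have hq0 : 0 < a * h ^ (2 * ρ + 1) := by positivity
  set p := h ^ (ρ + 1) with hpdef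
  set q := a * h ^ (2 * ρ + 1) with hqdef
  set W : ℕ := ⌈s / p⌉₊ with hW
  set M : ℕ := ⌈s / h ^ ρ⌉₊ with hM
  set E : ℕ := ⌈κ * (M + 1)⌉₊ with hE
  set D : ℕ := ⌈W + κ * (M + W + 1)⌉₊ with hD
  have hW1 : s / p ≤ W := Nat.le_ceil _
  have hM1 : s / h ^ ρ ≤ M := Nat.le_ceil _
  have hW2 : (W : ℝ) < s / p + 1 := Nat.ceil_lt_add_one (by positivity)
  have hM2 : (M : ℝ) < s / h ^ ρ + 1 := Nat.ceil_lt_add_one (by positivity)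
  have hE2 : (E : ℝ) < κ * (M + 1) + 1 := Nat.ceil_lt_add_one (by positivity)
  have hD2 : (D : ℝ) < W + κ * (M + W + 1) + 1 := Nat.ceil_lt_add_one (by positivity)
  have hρ0 : 0 < h ^ ρ := by positivity
  have hpW : W * p ≤ 2 * s := by
    have : W * p < (s / p + 1) * p := by gcongr
    rw [add_mul, div_mul_cancel₀ _ hp0.ne'] at this
    linarith
  have hMρ : M * h ^ ρ ≤ 2 * s := by
    have : M * h ^ ρ < (s / h ^ ρ + 1) * h ^ ρ := by gcongr
    rw [add_mul, div_mul_cancel₀ _ hρ0.ne'] at this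
    linarith
  have hpM : M * p ≤ 2 * s := by
    have : p ≤ h ^ ρ := by
      rw [hpdef, pow_succ]; exact mul_le_of_le_one_right hρ0.le hh1
    exact (by gcongr : M * p ≤ M * h ^ ρ).trans hMρ
  have hMone : (1 : ℝ) ≤ M := by
    have : 0 < M := Nat.ceil_pos.2 (by positivity)
    exact_mod_cast this
  have key := probBlue_le r hr hp0.le hq0 (by linarith) (by linarith) (τ := τ) (ρ := ρ) (W := W)
    (M := M) (D := D) (E := E) hρ (by rw [← mul_assoc]; exact Nat.le_ceil _)
    (by rw [← mul_assoc]; exact Nat.le_ceil _)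
  refine key.trans ?_
  have h1 : (1 - q) ^ (W * M) ≤ Real.exp (-(a * s ^ 2)) := by
    calc (1 - q) ^ (W * M) ≤ Real.exp (-q) ^ (W * M) := by
          gcongr
          · linarith
          · linarith [Real.add_one_le_exp (-q)]
      _ = Real.exp (-(q * (W * M))) := by
          rw [← Real.exp_nat_mul]; push_cast; ring_nf
      _ ≤ _ := by
          rw [Real.exp_le_exp, neg_le_neg_iff]
          calc a * s ^ 2 = q * (s / p * (s / h ^ ρ)) := by
                rw [hqdef, hpdef]; field_simp; ring
            _ ≤ _ := by gcongr
  have h2 : (2 * D + 1) * p ≤ (7 + 10 * κ) * s := by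
    calc (2 * D + 1) * p ≤ (2 * (W + κ * (M + W + 1) + 1) + 1) * p := by gcongr
      _ = 2 * (W * p) + 2 * κ * (M * p) + 2 * κ * (W * p) + 2 * κ * p + 3 * p := by ring
      _ ≤ 2 * (2 * s) + 2 * κ * (2 * s) + 2 * κ * (2 * s) + 2 * κ * s + 3 * s := by gcongr
      _ = _ := by ring
  have h3 : M * ((2 * E + 1) * p) ^ ρ ≤ (4 * κ + 3) ^ ρ * 2 ^ (ρ + 1) * s := by
    calc M * ((2 * E + 1) * p) ^ ρ ≤ M * (((4 * κ + 3) * M) * p) ^ ρ := by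
          gcongr
          nlinarith
      _ = (4 * κ + 3) ^ ρ * (M * h ^ ρ) ^ (ρ + 1) := by
          rw [hpdef, mul_pow, mul_pow, mul_pow]; ring
      _ ≤ (4 * κ + 3) ^ ρ * (2 * s) ^ (ρ + 1) := by gcongr
      _ = (4 * κ + 3) ^ ρ * 2 ^ (ρ + 1) * s ^ (ρ + 1) := by rw [mul_pow]; ring
      _ ≤ (4 * κ + 3) ^ ρ * 2 ^ (ρ + 1) * s := by
          gcongr
          exact pow_le_of_le_one hs.le hs1 (by omega)
  have h4 : Real.exp (-(a * s ^ 2)) ≤ 1 := Real.exp_le_one_iff.2 (by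
    have := mul_nonneg ha.le (sq_nonneg s); linarith)
  have h5 : (1 - Real.exp (-(a * s ^ 2))) *
      (1 - (7 + 10 * κ + (4 * κ + 3) ^ ρ * 2 ^ (ρ + 1)) * s) ≤
      (1 - (1 - q) ^ (W * M)) * (1 - ((2 * D + 1) * p + M * ((2 * E + 1) * p) ^ ρ)) := by
    refine mul_le_mul (by linarith) (by linarith) (by linarith) ?_
    linarith
  linarith

theorem probBlue_nonneg (r : ℝ) (B R : Set (ℤ × ℤ)) (p q : ℝ) : 0 ≤ probBlue r B R p q :=
  measureReal_nonneg

/-- The bound needs `p + q ≤ 1`, hence small `p`. It supplies the boundedness that real `limsup` and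
`liminf` require. -/
theorem eventually_probBlue_le_one (r : ℝ) (B R : Set (ℤ × ℤ)) (ρ : ℕ) {a : ℝ} (ha : 0 < a) :
    ∀ᶠ p : ℝ in 𝓝[>] 0, probBlue r B R p (a * p ^ (1 + (ρ : ℝ) / ((ρ : ℝ) + 1))) ≤ 1 := by
  filter_upwards [eventually_exists_scale ρ (h₀ := 1 / (a + 1)) (by positivity)] with p hp
  obtain ⟨h, hpos, hle, rfl, hq⟩ := hp
  rw [hq]
  rw [le_div_iff₀ (by positivity)] at hle
  have hh1 : h ≤ 1 := by nlinarith
  have h1 : h ^ (ρ + 1) ≤ h := pow_le_of_le_one hpos.le hh1 (by omega)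
  have h2 : h ^ (2 * ρ + 1) ≤ h := pow_le_of_le_one hpos.le hh1 (by omega)
  have := isProbabilityMeasure_law (p := h ^ (ρ + 1)) (q := a * h ^ (2 * ρ + 1)) (by positivity)
    (by positivity) (by nlinarith)
  exact measureReal_le_one

theorem limsup_probBlue (r : ℝ) (hr : 0 < r) (τ ρ : ℕ) (hρ : 1 ≤ ρ) :
    (∀ a : ℝ, 0 < a →
        limsup (fun p : ℝ => probBlue r (segment τ) (l1Ball ρ) p
          (a * p ^ (1 + (ρ : ℝ) / ((ρ : ℝ) + 1)))) (𝓝[>] 0) < 1) ∧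
      Tendsto (fun a : ℝ => limsup (fun p : ℝ => probBlue r (segment τ) (l1Ball ρ) p
        (a * p ^ (1 + (ρ : ℝ) / ((ρ : ℝ) + 1)))) (𝓝[>] 0)) atTop (𝓝 0) := by
  obtain ⟨C, hC, hle⟩ := exists_probBlue_le r hr τ ρ hρ
  have hcob : ∀ a : ℝ, IsCoboundedUnder (· ≤ ·) (𝓝[>] (0 : ℝ)) (fun p : ℝ =>
      probBlue r (segment τ) (l1Ball ρ) p (a * p ^ (1 + (ρ : ℝ) / ((ρ : ℝ) + 1)))) := fun a =>
    isCoboundedUnder_le_of_le _ (x := 0) fun p => probBlue_nonneg _ _ _ _ _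
  have hls : ∀ a : ℝ, 0 < a → ∀ s : ℝ, 0 < s → s ≤ 1 → C * s ≤ 1 →
      limsup (fun p : ℝ => probBlue r (segment τ) (l1Ball ρ) p
          (a * p ^ (1 + (ρ : ℝ) / ((ρ : ℝ) + 1)))) (𝓝[>] 0) ≤
        1 - (1 - Real.exp (-(a * s ^ 2))) * (1 - C * s) := fun a ha s h1 h2 h3 =>
    limsup_le_of_le (hcob a) (hle s h1 h2 h3 a ha)
  refine ⟨fun a ha => ?_, ?_⟩
  · have hs0 : 0 < min 1 (1 / (2 * C)) := by positivity
    set s := min 1 (1 / (2 * C)) with hs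
    have hCs : C * s ≤ 1 / 2 := by
      calc C * s ≤ C * (1 / (2 * C)) := by gcongr; exact min_le_right _ _
        _ = 1 / 2 := by field_simp
    refine (hls a ha s hs0 (min_le_left _ _) (by linarith)).trans_lt ?_
    have : Real.exp (-(a * s ^ 2)) < 1 := Real.exp_lt_one_iff.2 (by
      have := mul_pos ha (pow_pos hs0 2); linarith)
    have := mul_pos (by linarith : 0 < 1 - Real.exp (-(a * s ^ 2)))
      (by linarith : 0 < 1 - C * s)
    linarith
  · rw [Metric.tendsto_atTop]
    intro e he
    set s := min (min 1 (1 / C)) (e / (4 * C)) with hs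
    have hs0 : 0 < s := by positivity
    have hCs1 : C * s ≤ 1 := by
      calc C * s ≤ C * (1 / C) := by gcongr; exact (min_le_left _ _).trans (min_le_right _ _)
        _ = 1 := by field_simp
    have hCse : C * s ≤ e / 4 := by
      calc C * s ≤ C * (e / (4 * C)) := by gcongr; exact min_le_right _ _
        _ = e / 4 := by field_simp
    have hexp : Tendsto (fun a : ℝ => Real.exp (-(a * s ^ 2))) atTop (𝓝 0) :=
      Real.tendsto_exp_neg_atTop_nhds_zero.comp (tendsto_id.atTop_mul_const (by positivity))
    obtain ⟨a₀, ha₀⟩ := (((hexp.eventually_lt_const (show (0 : ℝ) < e / 4 by positivity)).and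
      (eventually_gt_atTop 0))).exists_forall_of_atTop
    refine ⟨a₀, fun a ha => ?_⟩
    obtain ⟨h1, h2⟩ := ha₀ a ha
    have h3 := hls a h2 s hs0 ((min_le_left _ _).trans (min_le_left _ _)) hCs1
    have h4 : 0 ≤ limsup (fun p : ℝ => probBlue r (segment τ) (l1Ball ρ) p
          (a * p ^ (1 + (ρ : ℝ) / ((ρ : ℝ) + 1)))) (𝓝[>] 0) :=
      le_limsup_of_frequently_le (Frequently.of_forall fun p => probBlue_nonneg _ _ _ _ _)
        (isBoundedUnder_of_eventually_le (eventually_probBlue_le_one _ _ _ ρ h2))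
    rw [Real.dist_eq, sub_zero, abs_of_nonneg h4]
    have h5 : 0 ≤ Real.exp (-(a * s ^ 2)) * (C * s) := by positivity
    nlinarith

end Scaling

/-! ### Walls of blue rows and the shrinking red-free strip -/

section Barriers

/-- There are `ρ` consecutive rows at heights in `[a, b)`, or at the opposite heights if `σ = -1`,
each of which holds an initially blue vertex with abscissa in `[(j + 2) w, (j + 3) w)`. -/
def HasWall (ω : Sample) (ρ a b w : ℕ) (σ j : ℤ) : Prop :=
  ∃ y₀ : ℕ, a ≤ y₀ ∧ y₀ + ρ ≤ b ∧ ∀ i < ρ, ∃ z : ℤ, (j + 2) * w ≤ z ∧ z < (j + 3) * w ∧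
    (ω (z, σ * ((y₀ + i : ℕ) : ℤ))).1 = Colour.blue

/-- A sequence that falls by at most `ρ` per step cannot jump over `ρ` consecutive values; the first
time below `a + ρ` does it. -/
theorem exists_mem_window {f : ℕ → ℤ} {n₁ n : ℕ} {a ρ : ℤ} (hn : n₁ ≤ n)
    (hstep : ∀ k, n₁ ≤ k → k < n → f k - ρ ≤ f (k + 1)) (h1 : a + ρ ≤ f n₁) (h2 : f n < a) (hρ : 0 ≤ ρ) :
    ∃ k, n₁ ≤ k ∧ k ≤ n ∧ a ≤ f k ∧ f k < a + ρ := by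
  have hex : ∃ k, n₁ ≤ k ∧ f k < a + ρ := ⟨n, hn, by omega⟩
  classical
  obtain ⟨h3, h4⟩ := Nat.find_spec hex
  set k := Nat.find hex with hk
  have hkn : k ≤ n := Nat.find_min' hex ⟨hn, by omega⟩
  refine ⟨k, h3, hkn, ?_, h4⟩
  have hne : k ≠ n₁ := by rintro h; rw [h] at h4; omega
  have hmin := Nat.find_min hex (m := k - 1) (by omega)
  have h5 : a + ρ ≤ f (k - 1) := by
    by_contra hc
    exact hmin ⟨by omega, by omega⟩
  have h6 := hstep (k - 1) (by omega) (by omega)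
  rw [show k - 1 + 1 = k by omega] at h6
  omega

variable {r : ℝ} {ω : Sample}

/-- The walls keep red out of a strip around row `0` whose height shrinks with time. -/
theorem le_abs_of_red (hr : 0 < r) {ρ M L : ℕ} {Λ : ℤ} {t F Δ : ℕ → ℕ}
    (ht : ∀ l, t (l + 1) = t l + Δ l) (hF : ∀ l, F (l + 1) ≤ F l) (hF0 : F 0 + ρ * t 0 ≤ M)
    (hΔpos : ∀ l, 0 < ρ * Δ l) (hΔ : ∀ l, (4 * (ρ * Δ l : ℕ) : ℝ) + 1 ≤ r * t l)
    (hno : ∀ x y : ℤ, |x| ≤ Λ → |y| ≤ M → (ω (x, y)).1 ≠ Colour.red)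
    (hwall : ∀ l < L, ∀ z : ℤ × ℤ, (ω z).1 = Colour.red → |z.1| ≤ Λ →
      |z.2| ≤ M + ρ * t (l + 1) → ∀ j : ℤ, |j * (ρ * Δ l : ℕ) - z.1| ≤ ρ * t l + ρ * Δ l →
      -Λ ≤ (j + 2) * (ρ * Δ l : ℕ) → (j + 3) * (ρ * Δ l : ℕ) ≤ Λ →
      ∀ σ : ℤ, σ = 1 ∨ σ = -1 → HasWall ω ρ (F (l + 1)) (F l) (ρ * Δ l) σ j)
    {l : ℕ} (hl : l ≤ L) {n : ℕ} (hn : redCount r n ≤ t l) {x y : ℤ}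
    (hx : |x| ≤ Λ - 4 * (ρ * t l)) (hred : config r {(1, 0)} (l1Ball ρ) ω n (x, y) = Colour.red) :
    (F l : ℤ) ≤ |y| := by
  have hFM : ∀ l, F l ≤ M := fun l =>
    (antitone_nat_of_succ_le hF (Nat.zero_le l)).trans ((Nat.le_add_right _ _).trans hF0)
  induction l generalizing n x y with
  | zero =>
    obtain ⟨γ, h1, h2, h3⟩ := exists_red_path hr hred
    have h4 := path_dist h3 (Nat.zero_le n) le_rfl
    rw [h1, redCount_zero] at h4
    -- Before time `t 0` red travels at most `ρ * t 0`, so its ancestor would lie in the red-free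
    -- box.
    have hle : (ρ : ℤ) * ((redCount r n : ℤ) - (0 : ℕ)) ≤ ρ * t 0 := by
      gcongr
      simpa using hn
    have h5 := abs_sub_abs_le_abs_sub (γ 0).1 x
    have h6 := abs_sub_abs_le_abs_sub (γ 0).2 y
    rw [abs_sub_comm] at h5 h6
    have h7 := abs_nonneg (x - (γ 0).1)
    have h8 := abs_nonneg (y - (γ 0).2)
    have h9 : (0 : ℤ) ≤ ρ * t 0 := by positivity
    by_contra hc
    refine hno (γ 0).1 (γ 0).2 (by simp only at h4; linarith) ?_ (h2 0 (Nat.zero_le n))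
    have : (F 0 : ℤ) + ρ * t 0 ≤ M := by exact_mod_cast hF0
    simp only at h4
    linarith
  | succ l ih =>
    set w : ℕ := ρ * Δ l with hw
    have htl : (t (l + 1) : ℤ) = t l + Δ l := by exact_mod_cast ht l
    have hwl : (w : ℤ) = ρ * Δ l := by rw [hw]; push_cast; rfl
    have hρt : (ρ : ℤ) * t (l + 1) = ρ * t l + w := by rw [htl, hwl]; ring
    have hwpos : (0 : ℤ) < w := by exact_mod_cast hΔpos l
    rcases le_or_gt (redCount r n) (t l) with hle | hgt
    · have := ih (by omega) hle (x := x) (y := y) (by linarith) hred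
      have h2 : (F (l + 1) : ℤ) ≤ F l := by exact_mod_cast hF l
      linarith
    by_contra! hc
    obtain ⟨γ, h1, h2, h3⟩ := exists_red_path hr hred
    -- The ancestral path is stopped at red time `t l`: by induction it is then at height at least
    -- `F l`, and afterwards it moves by at most `w`.
    obtain ⟨n₁, hn₁, he⟩ := exists_redCount_eq hr hgt.le
    have hdist : ∀ k, n₁ ≤ k → k ≤ n → |(γ k).1 - (γ n₁).1| + |(γ k).2 - (γ n₁).2| ≤ w := by
      intro k hk hkn
      refine (path_dist h3 hk hkn).trans ?_
      rw [he, hwl]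
      have : (redCount r k : ℤ) ≤ redCount r n := by exact_mod_cast redCount_mono hr hkn
      have : (redCount r n : ℤ) ≤ t (l + 1) := by exact_mod_cast hn
      gcongr
      linarith
    have hd1 := hdist n hn₁ le_rfl
    rw [h1] at hd1
    simp only at hd1
    set x₁ := (γ n₁).1 with hx₁
    set y₁ := (γ n₁).2 with hy₁
    have ha1 := abs_nonneg (x - x₁)
    have ha2 := abs_nonneg (y - y₁)
    have ha3 := abs_sub_abs_le_abs_sub x₁ x
    rw [abs_sub_comm] at ha3
    have hx₁Λ : |x₁| + 3 * w ≤ Λ - 4 * (ρ * t l) := by linarith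
    have hy₁F : (F l : ℤ) ≤ |y₁| :=
      ih (by omega) he.le (x := x₁) (y := y₁) (by linarith) (h2 n₁ hn₁)
    obtain ⟨σ, hσ, hσy⟩ : ∃ σ : ℤ, (σ = 1 ∨ σ = -1) ∧ σ * y₁ = |y₁| := by
      rcases le_total 0 y₁ with h | h
      · exact ⟨1, Or.inl rfl, by rw [abs_of_nonneg h, one_mul]⟩
      · exact ⟨-1, Or.inr rfl, by rw [abs_of_nonpos h, neg_one_mul]⟩
    have hσabs : ∀ v : ℤ, |σ * v| = |v| := by
      intro v; rcases hσ with rfl | rfl <;> simp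
    have hσσ : ∀ v : ℤ, σ * (σ * v) = v := by
      intro v; rcases hσ with rfl | rfl <;> simp
    -- Cell `j` contains `x₁`. The rest of the path stays to the left of `(j + 2) * w`, where the
    -- wall cell begins, and any point of that cell is within `4 * w` of the path.
    set j := x₁ / w with hj
    have hj1 : j * w ≤ x₁ := Int.ediv_mul_le x₁ hwpos.ne'
    have hj2 : x₁ < (j + 1) * w := Int.lt_ediv_add_one_mul_self x₁ hwpos
    have e1 : (j + 1) * (w : ℤ) = j * w + w := by ring
    have e2 : (j + 2) * (w : ℤ) = j * w + 2 * w := by ring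
    have e3 : (j + 3) * (w : ℤ) = j * w + 3 * w := by ring
    have hρtl : (0 : ℤ) ≤ ρ * t l := by positivity
    have hx₁a := abs_le.1 (le_refl |x₁|)
    have hz0 := path_dist h3 (Nat.zero_le n₁) hn₁
    have hz1 := path_dist h3 (Nat.zero_le n) le_rfl
    rw [redCount_zero, he] at hz0
    rw [redCount_zero, h1] at hz1
    have hcn : (ρ : ℤ) * ((redCount r n : ℤ) - (0 : ℕ)) ≤ ρ * t (l + 1) := by
      gcongr
      simpa using hn
    obtain ⟨y₀, hy₀, hy₀', hz⟩ := hwall l (by omega) (γ 0) (h2 0 (Nat.zero_le n)) (by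
        have h5 := abs_sub_abs_le_abs_sub (γ 0).1 x
        rw [abs_sub_comm] at h5
        have := abs_nonneg (y - (γ 0).2)
        simp only at hz1
        linarith) (by
        have h5 := abs_sub_abs_le_abs_sub (γ 0).2 y
        rw [abs_sub_comm] at h5
        have := abs_nonneg (x - (γ 0).1)
        have : (F (l + 1) : ℤ) ≤ M := by exact_mod_cast hFM (l + 1)
        simp only at hz1
        linarith) j (by
        have h5 := abs_le.1 (le_refl |x₁ - (γ 0).1|)
        have := abs_nonneg (y₁ - (γ 0).2)
        simp only [Nat.cast_zero, sub_zero] at hz0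
        rw [abs_le]
        constructor <;> linarith) (by rw [e2]; linarith) (by rw [e3]; linarith) σ hσ
    have hy₀F : (F (l + 1) : ℤ) ≤ y₀ := by exact_mod_cast hy₀
    have hy₀F' : (y₀ : ℤ) + ρ ≤ F l := by exact_mod_cast hy₀'
    -- On its way from height `F l` to below `F (l + 1)` the path must visit one of the `ρ` rows of
    -- the wall.
    obtain ⟨k, hk1, hk2, hk3, hk4⟩ := exists_mem_window (f := fun k => σ * (γ k).2) (a := y₀)
      (ρ := ρ) hn₁ (by
        intro k _ hkn
        have h5 := h3 k hkn
        have h6 : (redCount r (k + 1) : ℤ) - redCount r k ≤ 1 := by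
          rcases redCount_succ hr k with h | h <;> rw [h.2] <;> simp
        have h7 : (ρ : ℤ) * ((redCount r (k + 1) : ℤ) - redCount r k) ≤ ρ * 1 := by gcongr
        have h8 := abs_nonneg ((γ (k + 1)).1 - (γ k).1)
        have h9 := hσabs ((γ (k + 1)).2 - (γ k).2)
        have h10 := neg_abs_le (σ * ((γ (k + 1)).2 - (γ k).2))
        rw [mul_sub] at h9 h10
        linarith) (by
        change (y₀ : ℤ) + ρ ≤ σ * y₁
        linarith) (by
        have := le_abs_self (σ * y)
        rw [hσabs] at this
        rw [h1]
        simp only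
        linarith) (by positivity)
    obtain ⟨z, hz1, hz2, hzb⟩ := hz (σ * (γ k).2 - y₀).toNat (by omega)
    have hrow : σ * ((y₀ + (σ * (γ k).2 - y₀).toNat : ℕ) : ℤ) = (γ k).2 := by
      push_cast
      rw [Int.toNat_of_nonneg (by omega), add_sub_cancel, hσσ]
    rw [hrow] at hzb
    have hdk := hdist k hk1 hk2
    have hb1 := abs_nonneg ((γ k).2 - y₁)
    have hb2 := abs_le.1 (le_refl |(γ k).1 - x₁|)
    have hzx : 0 ≤ z - (γ k).1 := by rw [e2] at hz1; linarith
    have hzx' : z - (γ k).1 ≤ 4 * w := by rw [e3] at hz2; linarith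
    have hbc : 4 * w ≤ blueCount r n₁ := by
      have h5 := mul_redCount_le_blueCount hr n₁
      rw [he] at h5
      have h6 := hΔ l
      have : ((4 * w : ℕ) : ℝ) ≤ blueCount r n₁ := by
        rw [hw]; push_cast; push_cast at h6; linarith
      exact_mod_cast this
    -- By time `t l` blue has made `4 * w` updates, and by induction its way from `z` was free of
    -- red. The visited vertex is thus blue before red arrives. The margin `4 * (ρ * t l)` loses `4
    -- * w` per layer: `w` for the path and `3 * w` for the reach of the wall cell.
    have hblue := blue_of_initial_blue (R := l1Ball ρ) hr (n := n₁) hzb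
      (k := (z - (γ k).1).toNat) (by omega) (by
        intro j' hj' hcon
        have h5 := ih (by omega) he.le (x := z - j') (y := (γ k).2) (by
          have h6 : (j' : ℤ) ≤ z - (γ k).1 := by omega
          have h7 := hx₁a
          rw [e3] at hz2
          refine (abs_le.2 ⟨?_, ?_⟩ : |z - (j' : ℤ)| ≤ |x₁| + 3 * w).trans hx₁Λ
          · linarith
          · have : (0 : ℤ) ≤ j' := by positivity
            linarith) hcon
        rw [← hσabs, abs_of_nonneg (by omega)] at h5
        omega)
    rw [Int.toNat_of_nonneg hzx, sub_sub_cancel] at hblue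
    have h5 := config_eq_of_le hk1 hblue (by simp)
    have h6 := h2 k hk2
    rw [h6] at h5
    exact absurd h5 (by simp)

/-- As `F L > 0`, row 0 is still free of red near the origin at time `t L`, when blue has made at
least `X` updates. -/
theorem eventuallyBlue_of_walls (hr : 0 < r) {ρ M L : ℕ} {Λ : ℤ} {t F Δ : ℕ → ℕ}
    (ht : ∀ l, t (l + 1) = t l + Δ l) (hF : ∀ l, F (l + 1) ≤ F l) (hF0 : F 0 + ρ * t 0 ≤ M)
    (hΔpos : ∀ l, 0 < ρ * Δ l) (hΔ : ∀ l, (4 * (ρ * Δ l : ℕ) : ℝ) + 1 ≤ r * t l)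
    (hno : ∀ x y : ℤ, |x| ≤ Λ → |y| ≤ M → (ω (x, y)).1 ≠ Colour.red)
    (hwall : ∀ l < L, ∀ z : ℤ × ℤ, (ω z).1 = Colour.red → |z.1| ≤ Λ →
      |z.2| ≤ M + ρ * t (l + 1) → ∀ j : ℤ, |j * (ρ * Δ l : ℕ) - z.1| ≤ ρ * t l + ρ * Δ l →
      -Λ ≤ (j + 2) * (ρ * Δ l : ℕ) → (j + 3) * (ρ * Δ l : ℕ) ≤ Λ →
      ∀ σ : ℤ, σ = 1 ∨ σ = -1 → HasWall ω ρ (F (l + 1)) (F l) (ρ * Δ l) σ j)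
    (hFL : 0 < F L) {X : ℕ} (hX : (X : ℝ) + 1 ≤ r * t L) (hXΛ : (X : ℤ) ≤ Λ - 4 * (ρ * t L))
    (hblue : ∃ x ≤ X, (ω ((x : ℤ), 0)).1 = Colour.blue) :
    EventuallyBlue r {(1, 0)} (l1Ball ρ) ω (0, 0) := by
  obtain ⟨x, hx, hb⟩ := hblue
  obtain ⟨m, hm⟩ := exists_le_redCount hr (t L)
  obtain ⟨n, -, hn⟩ := exists_redCount_eq hr hm
  have h1 := mul_redCount_le_blueCount hr n
  rw [hn] at h1
  have h2 : X ≤ blueCount r n := by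
    have : (X : ℝ) ≤ blueCount r n := by linarith
    exact_mod_cast this
  refine ⟨n, ?_⟩
  have h3 := blue_of_initial_blue (R := l1Ball ρ) hr (n := n) hb (k := x) (by omega) (by
    intro j hj hcon
    have h4 := le_abs_of_red hr ht hF hF0 hΔpos hΔ hno hwall le_rfl hn.le (by
      rw [abs_of_nonneg (by omega)]; omega) hcon
    simp at h4
    omega)
  simpa using h3

end Barriers

/-! ### Probability that a wall is missing -/

section WallProbability

theorem dependsOn_compl {ι X : Type*} {A : Set (ι → X)} {S : Set ι} (h : DependsOn (· ∈ A) S) :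
    DependsOn (· ∈ Aᶜ) S := fun x y hxy => by
  simpa using congrArg Not (h hxy)

variable {m : ℤ × ℤ → Measure (Colour × Bool)} [∀ i, IsProbabilityMeasure (m i)]

/-- A red vertex in one place and the absence of a wall in another are independent, and the absence
of a wall is unlikely. -/
theorem prob_red_inter_noWall_le {p : ℝ} (hp : 0 ≤ p) (hp1 : p ≤ 1) {ρ a b w g : ℕ} {σ j : ℤ}
    (hσ : σ = 1 ∨ σ = -1) (hab : a + ρ * g ≤ b)
    (hm : ∀ (x : ℤ) (y : ℕ), (j + 2) * w ≤ x → x < (j + 3) * w → y < b →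
      (m (x, σ * y)).real {s | s.1 ≠ Colour.blue} ≤ 1 - p)
    {z : ℤ × ℤ} (hz : (b : ℤ) ≤ |z.2|) :
    (Measure.infinitePi m).real ({ω | (ω z).1 = Colour.red} ∩ {ω | ¬ HasWall ω ρ a b w σ j}) ≤
      (m z).real {s | s.1 = Colour.red} * (1 - (1 - (1 - p) ^ w) ^ ρ) ^ g := by
  classical
  set μ := Measure.infinitePi m with hμ
  set I : Finset ℤ := Finset.Ico ((j + 2) * w) ((j + 3) * w) with hI
  have hIcard : I.card = w := by
    rw [hI, Int.card_Ico, show (j + 3) * (w : ℤ) - (j + 2) * w = w by ring, Int.toNat_natCast]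
  have hσinj : ∀ u v : ℕ, σ * (u : ℤ) = σ * v → u = v := by
    rcases hσ with rfl | rfl <;> intro u v h <;> omega
  have hσabs : ∀ v : ℕ, |σ * (v : ℤ)| = v := by
    intro v; rcases hσ with rfl | rfl <;> simp
  set row : ℕ → Finset (ℤ × ℤ) := fun y => I ×ˢ {σ * (y : ℤ)} with hrow
  set rowBlue : ℕ → Set Sample := fun y => {ω | ∃ s ∈ row y, (ω s).1 = Colour.blue} with hrowBlue
  set rows : ℕ → Finset (ℤ × ℤ) := fun k => (Finset.range ρ).biUnion fun i => row (a + ρ * k + i)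
    with hrows
  set group : ℕ → Set Sample := fun k => ⋂ i ∈ Finset.range ρ, rowBlue (a + ρ * k + i) with hgroup
  have hrowdisj : ∀ u v : ℕ, u ≠ v → Disjoint (row u) (row v) := by
    intro u v huv
    rw [Finset.disjoint_left]
    intro s hs hs'
    simp only [hrow, Finset.mem_product, Finset.mem_singleton] at hs hs'
    exact huv (hσinj u v (hs.2.symm.trans hs'.2))
  have hrowdep : ∀ y, DependsOn (· ∈ rowBlue y) (row y : Set (ℤ × ℤ)) := by
    intro y ω ω' h
    simp only [hrowBlue, Set.mem_ofPred_eq, eq_iff_iff]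
    refine exists_congr fun s => and_congr_right fun hs => ?_
    rw [h s hs]
  have hgroupdep : ∀ k, DependsOn (· ∈ group k) (rows k : Set (ℤ × ℤ)) := by
    intro k ω ω' h
    simp only [hgroup, Set.mem_iInter, eq_iff_iff]
    refine forall₂_congr fun i hi => iff_of_eq (hrowdep (a + ρ * k + i) fun s hs => h s ?_)
    exact Finset.mem_coe.2 (Finset.mem_biUnion.2 ⟨i, hi, hs⟩)
  have hlt : ∀ k < g, ∀ i < ρ, a + ρ * k + i < b := by
    intro k hk i hi
    have : ρ * (k + 1) ≤ ρ * g := Nat.mul_le_mul_left _ hk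
    rw [mul_add] at this
    omega
  have hprow : ∀ y < b, 1 - (1 - p) ^ w ≤ μ.real (rowBlue y) := by
    intro y hy
    have hc : rowBlue y = (Set.pi (row y) fun _ => {s | s.1 ≠ Colour.blue})ᶜ := by
      ext ω; simp [hrowBlue]
    rw [hc, probReal_compl_eq_one_sub
      (MeasurableSet.pi (Finset.countable_toSet _) fun _ _ => (Set.toFinite _).measurableSet),
      hμ, infinitePi_real_pi fun _ _ => (Set.toFinite _).measurableSet]
    have : ∏ s ∈ row y, (m s).real {s | s.1 ≠ Colour.blue} ≤ ∏ s ∈ row y, (1 - p) := by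
      refine Finset.prod_le_prod (fun _ _ => measureReal_nonneg) fun s hs => ?_
      simp only [hrow, hI, Finset.mem_product, Finset.mem_singleton, Finset.mem_Ico] at hs
      obtain ⟨s1, s2⟩ := s
      simp only at hs
      rw [hs.2]
      exact hm s1 y hs.1.1 hs.1.2 hy
    rw [Finset.prod_const, hrow, Finset.card_product, Finset.card_singleton, mul_one, hIcard]
      at this
    linarith
  have hu0 : 0 ≤ 1 - (1 - p) ^ w := by
    have := pow_le_one₀ (n := w) (by linarith : 0 ≤ 1 - p) (by linarith)
    linarith
  have hpgroup : ∀ k < g, (1 - (1 - p) ^ w) ^ ρ ≤ μ.real (group k) := by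
    intro k hk
    rw [measureReal_def, hμ, hgroup, infinitePi_biInter_of_dependsOn (Finset.range ρ)
      (S := fun i => row (a + ρ * k + i)) (fun i _ i' _ hne => hrowdisj _ _ (by omega))
      fun i _ => hrowdep _, ENNReal.toReal_prod]
    calc (1 - (1 - p) ^ w) ^ ρ = ∏ i ∈ Finset.range ρ, (1 - (1 - p) ^ w) := by simp
      _ ≤ _ := Finset.prod_le_prod (fun _ _ => hu0) fun i hi =>
          hprow _ (hlt k hk i (Finset.mem_range.1 hi))
  have hgm : ∀ k, MeasurableSet (group k) := fun k => measurableSet_of_dependsOn (hgroupdep k)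
  have hzdep : DependsOn (· ∈ {ω : Sample | (ω z).1 = Colour.red})
      (({z} : Finset (ℤ × ℤ)) : Set (ℤ × ℤ)) := by
    intro ω ω' h
    simp only [Set.mem_ofPred_eq, eq_iff_iff]
    rw [h z (by simp)]
  -- Only `g` disjoint groups of `ρ` rows are tried, so that the attempts are independent. As `b ≤
  -- |z.2|`, the vertex `z` lies in none of them.
  have hsub : ({ω : Sample | ¬ HasWall ω ρ a b w σ j}) ⊆ ⋂ k ∈ Finset.range g, (group k)ᶜ := by
    intro ω hω
    simp only [Set.mem_iInter, Set.mem_compl_iff, Finset.mem_range]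
    intro k hk hgk
    simp only [hgroup, Set.mem_iInter, Finset.mem_range] at hgk
    have hle : ρ * (k + 1) ≤ ρ * g := Nat.mul_le_mul_left _ hk
    rw [mul_add] at hle
    refine hω ⟨a + ρ * k, by omega, by omega, fun i hi => ?_⟩
    obtain ⟨s, hs, hb⟩ := hgk i hi
    simp only [hrow, hI, Finset.mem_product, Finset.mem_singleton, Finset.mem_Ico] at hs
    refine ⟨s.1, hs.1.1, hs.1.2, ?_⟩
    rw [← hs.2]
    exact hb
  have hredz : μ.real {ω : Sample | (ω z).1 = Colour.red} = (m z).real {s | s.1 = Colour.red} := by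
    have : {ω : Sample | (ω z).1 = Colour.red} =
        Set.pi (({z} : Finset (ℤ × ℤ)) : Set (ℤ × ℤ)) fun _ => {s | s.1 = Colour.red} := by
      ext; simp
    rw [this, hμ, infinitePi_real_pi fun _ _ => (Set.toFinite _).measurableSet]
    simp
  calc _ ≤ μ.real ({ω | (ω z).1 = Colour.red} ∩ ⋂ k ∈ Finset.range g, (group k)ᶜ) :=
        measureReal_mono (Set.inter_subset_inter_right _ hsub)
    _ = (m z).real {s | s.1 = Colour.red} * ∏ k ∈ Finset.range g, μ.real (group k)ᶜ := by
        rw [measureReal_def, hμ, infinitePi_inter_of_dependsOn (S := {z})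
          (T := (Finset.range g).biUnion rows) ?_ hzdep ?_, ENNReal.toReal_mul,
          infinitePi_biInter_of_dependsOn (Finset.range g) (S := rows) ?_
            (fun k _ => dependsOn_compl (hgroupdep k)), ENNReal.toReal_prod,
          ← measureReal_def, ← hμ, hredz]
        · rfl
        · intro k _ l _ hkl
          simp only [hrows, Finset.disjoint_biUnion_left, Finset.disjoint_biUnion_right,
            Finset.mem_range]
          intro i hi i' hi'
          refine hrowdisj _ _ ?_
          rcases Nat.lt_or_gt_of_ne hkl with h | h
          · have := Nat.mul_le_mul_left ρ h
            rw [Nat.succ_eq_add_one, mul_add] at this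
            omega
          · have := Nat.mul_le_mul_left ρ h
            rw [Nat.succ_eq_add_one, mul_add] at this
            omega
        · rw [Finset.disjoint_singleton_left]
          simp only [hrows, hrow, Finset.mem_biUnion, Finset.mem_range, Finset.mem_product,
            Finset.mem_singleton, not_exists, not_and]
          intro k hk i hi _ hc
          rw [hc, hσabs] at hz
          have := hlt k hk i hi
          omega
        · intro ω ω' h
          simp only [Set.mem_iInter, eq_iff_iff]
          refine forall₂_congr fun k hk =>
            iff_of_eq (dependsOn_compl (hgroupdep k) fun s hs => h s ?_)
          exact Finset.mem_coe.2 (Finset.mem_biUnion.2 ⟨k, hk, hs⟩)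
    _ ≤ _ := by
        gcongr
        calc ∏ k ∈ Finset.range g, μ.real (group k)ᶜ
            ≤ ∏ k ∈ Finset.range g, (1 - (1 - (1 - p) ^ w) ^ ρ) := by
              refine Finset.prod_le_prod (fun _ _ => measureReal_nonneg) fun k hk => ?_
              rw [probReal_compl_eq_one_sub (hgm k)]
              linarith [hpgroup k (Finset.mem_range.1 hk)]
          _ = _ := by simp

end WallProbability

/-! ### Lower bound for the probability that blue wins -/

section BlueWins

/-- Excluding red only favours blue: `1 - p - q ≤ (1 - p) * (1 - q)`. -/
theorem cond_ne_red_ne_blue_le {p q : ℝ} (hp : 0 ≤ p) (hq : 0 ≤ q) (hpq : p + q ≤ 1)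
    (hq1 : q < 1) :
    (ProbabilityTheory.cond (siteLaw p q) {s | s.1 ≠ Colour.red}).real
      {s | s.1 ≠ Colour.blue} ≤ 1 - p := by
  have hset : {s : Colour × Bool | s.1 ≠ Colour.red} ∩ {s | s.1 ≠ Colour.blue} =
      {s | s.1 = Colour.empty} := by
    ext s
    simp only [Set.mem_inter_iff, Set.mem_ofPred_eq]
    cases s.1 <;> simp
  rw [measureReal_def, ProbabilityTheory.cond_apply (Set.toFinite _).measurableSet, hset,
    siteLaw_ne_red hp hq hpq, siteLaw_empty, ENNReal.toReal_mul, ENNReal.toReal_inv,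
    ENNReal.toReal_ofReal (by linarith), ENNReal.toReal_ofReal (by linarith),
    inv_mul_le_iff₀ (by linarith)]
  nlinarith [mul_nonneg hp hq]

/-- A lower bound for the probability that blue wins at the origin: there is no red in a box, red
from outside meets walls in all the cells it may enter, and row `0` holds a blue vertex. -/
theorem le_probBlue {r : ℝ} (hr : 0 < r) {p q : ℝ} (hp : 0 ≤ p) (hq : 0 ≤ q) (hq1 : q < 1)
    (hpq : p + q ≤ 1) {ρ M L Λ c X : ℕ} {t F Δ g : ℕ → ℕ}
    (ht : ∀ l, t (l + 1) = t l + Δ l) (hF : ∀ l, F (l + 1) ≤ F l) (hF0 : F 0 + ρ * t 0 ≤ M)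
    (hg : ∀ l < L, F (l + 1) + ρ * g l ≤ F l)
    (hΔpos : ∀ l, 0 < ρ * Δ l) (hΔ : ∀ l, (4 * (ρ * Δ l : ℕ) : ℝ) + 1 ≤ r * t l)
    (hc : ∀ l, ρ * t l + ρ * Δ l ≤ c * (ρ * Δ l))
    (hFL : 0 < F L) (hX : (X : ℝ) + 1 ≤ r * t L) (hXΛ : X + 4 * (ρ * t L) ≤ Λ) :
    (1 - q) ^ ((2 * Λ + 1) * (2 * M + 1)) * (1 - (1 - p) ^ (X + 1) -
      ∑ l ∈ Finset.range L, (2 * Λ + 1) * (2 * (ρ * t (l + 1))) * (2 * c + 1) * 2 *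
        (q * (1 - (1 - (1 - p) ^ (ρ * Δ l)) ^ ρ) ^ g l)) ≤
    probBlue r {(1, 0)} (l1Ball ρ) p q := by
  classical
  have hsite := isProbabilityMeasure_siteLaw hp hq hpq
  have hlaw := isProbabilityMeasure_law hp hq hpq
  have hFM : ∀ l, F l ≤ M := fun l =>
    (antitone_nat_of_succ_le hF (Nat.zero_le l)).trans ((Nat.le_add_right _ _).trans hF0)
  set box : Finset (ℤ × ℤ) := Finset.Icc (-(Λ : ℤ)) Λ ×ˢ Finset.Icc (-(M : ℤ)) M with hbox
  have hmembox : ∀ s : ℤ × ℤ, s ∈ box ↔ |s.1| ≤ Λ ∧ |s.2| ≤ M := by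
    intro s; simp [hbox, abs_le]
  set A : ℤ × ℤ → Set (Colour × Bool) := fun s =>
    if s ∈ box then {s | s.1 ≠ Colour.red} else Set.univ with hA
  have hAm : ∀ s, MeasurableSet (A s) := fun _ => (Set.toFinite _).measurableSet
  have h0 : ∀ s, siteLaw p q (A s) ≠ 0 := by
    intro s
    simp only [hA]
    split_ifs
    · rw [siteLaw_ne_red hp hq hpq]; simpa using hq1
    · simp
  set m : ℤ × ℤ → Measure (Colour × Bool) := fun s => ProbabilityTheory.cond (siteLaw p q) (A s)
    with hm
  have hmp : ∀ s, IsProbabilityMeasure (m s) :=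
    fun s => ProbabilityTheory.cond_isProbabilityMeasure (h0 s)
  have hcond : ProbabilityTheory.cond (law p q) (Set.pi box A) = Measure.infinitePi m :=
    cond_infinitePi (m := fun _ => siteLaw p q) hAm (fun s hs => by simp only [hA, if_neg hs]) h0
  have hpm : MeasurableSet (Set.pi (box : Set (ℤ × ℤ)) A) :=
    MeasurableSet.pi (Finset.countable_toSet _) fun s _ => hAm s
  set μ := Measure.infinitePi m with hμ
  have hmblue : ∀ s ∈ box, (m s).real {s | s.1 ≠ Colour.blue} ≤ 1 - p := by
    intro s hs
    simp only [hm, hA, if_pos hs]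
    exact cond_ne_red_ne_blue_le hp hq hpq hq1
  have hmred : ∀ s ∉ box, (m s).real {s | s.1 = Colour.red} = q := by
    intro s hs
    simp only [hm, hA, if_neg hs, ProbabilityTheory.cond_univ]
    exact siteLaw_real_red hq
  set w : ℕ → ℕ := fun l => ρ * Δ l with hw
  set Z : ℕ → Finset (ℤ × ℤ) := fun l => Finset.Icc (-(Λ : ℤ)) Λ ×ˢ
    (Finset.Ioc (M : ℤ) (M + ρ * t (l + 1)) ∪ Finset.Ico (-(M + ρ * t (l + 1)) : ℤ) (-M)) with hZ
  set J : ℕ → ℤ × ℤ → Finset ℤ := fun l z => Finset.Icc (z.1 / w l - c) (z.1 / w l + c) with hJ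
  -- A wall is required only where a red vertex `z` could come, so each bad event carries a factor
  -- `q`. Its cell must lie in the box, where the conditioned law favours blue, while `z` lies
  -- outside; hence the independence.
  set bad : ℕ → ℤ × ℤ → ℤ → ℤ → Set Sample := fun l z j σ =>
    {ω | -(Λ : ℤ) ≤ (j + 2) * (w l) ∧ (j + 3) * (w l) ≤ (Λ : ℤ) ∧ (ω z).1 = Colour.red ∧
      ¬ HasWall ω ρ (F (l + 1)) (F l) (w l) σ j} with hbad
  set noBlue : Set Sample := {ω | ∀ x ≤ X, (ω ((x : ℤ), 0)).1 ≠ Colour.blue} with hnoBlue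
  set Bad : Set Sample := noBlue ∪
    ⋃ l ∈ Finset.range L, ⋃ z ∈ Z l, ⋃ j ∈ J l z, ⋃ σ ∈ ({1, -1} : Finset ℤ), bad l z j σ with hBad
  have hsub : Set.pi box A ∩ Badᶜ ⊆
      {ω | EventuallyBlue r {(1, 0)} (l1Ball ρ) ω (0, 0)} := by
    rintro ω ⟨h1, h2⟩
    simp only [hBad, Set.mem_compl_iff, Set.mem_union, Set.mem_iUnion, not_or, not_exists] at h2
    obtain ⟨h2, h3⟩ := h2
    have hno : ∀ x y : ℤ, |x| ≤ Λ → |y| ≤ M → (ω (x, y)).1 ≠ Colour.red := by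
      intro x y hx hy
      have hs : (x, y) ∈ box := (hmembox _).2 ⟨hx, hy⟩
      have := h1 (x, y) hs
      simp only [hA, if_pos hs] at this
      exact this
    refine eventuallyBlue_of_walls (X := X) (Λ := Λ) hr ht hF hF0 hΔpos hΔ hno ?_ hFL hX
      (by push_cast at *; have : ((X + 4 * (ρ * t L) : ℕ) : ℤ) ≤ Λ := by exact_mod_cast hXΛ
          push_cast at this; linarith) ?_
    · intro l hl z hz hz1 hz2 j hj hj1 hj2 σ hσ
      by_contra hcon
      have hw0 : (0 : ℤ) < w l := by exact_mod_cast hΔpos l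
      refine h3 l (Finset.mem_range.2 hl) z ?_ j ?_ σ (by simpa using hσ) ⟨hj1, hj2, hz, hcon⟩
      · have hz3 : ¬ |z.2| ≤ M := fun h => hno z.1 z.2 hz1 h hz
        rw [abs_le] at hz1 hz2 hz3
        simp only [hZ, Finset.mem_product, Finset.mem_union, Finset.mem_Icc, Finset.mem_Ioc,
          Finset.mem_Ico]
        refine ⟨hz1, ?_⟩
        omega
      · have hj' : |j * (w l) - z.1| ≤ c * w l := hj.trans (by exact_mod_cast hc l)
        rw [abs_le] at hj'
        have e1 := Int.ediv_mul_le z.1 hw0.ne'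
        have e2 := Int.lt_ediv_add_one_mul_self z.1 hw0
        rw [hJ, Finset.mem_Icc]
        constructor
        · have : (z.1 / w l - c) * (w l) ≤ j * w l := by rw [sub_mul]; linarith
          exact le_of_mul_le_mul_right this hw0
        · have : j * (w l) < (z.1 / w l + c + 1) * w l := by
            have : (z.1 / w l + c + 1) * (w l : ℤ) = (z.1 / w l + 1) * w l + c * w l := by ring
            linarith
          have := lt_of_mul_lt_mul_right this hw0.le
          omega
    · simp only [hnoBlue, Set.mem_ofPred_eq] at h2
      push Not at h2
      exact h2
  have hpnoBlue : μ.real noBlue ≤ (1 - p) ^ (X + 1) := by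
    set e : ℕ ↪ ℤ × ℤ := ⟨fun x => ((x : ℤ), 0), fun a b h => by simpa using h⟩ with he
    have : noBlue = Set.pi ((Finset.range (X + 1)).map e : Finset (ℤ × ℤ))
        fun _ => {s | s.1 ≠ Colour.blue} := by
      ext ω
      simp only [hnoBlue, Set.mem_ofPred_eq, Finset.coe_map, Set.mem_pi, Set.forall_mem_image,
        Finset.mem_coe, Finset.mem_range, Nat.lt_succ_iff]
      rfl
    rw [this, hμ, infinitePi_real_pi fun _ _ => (Set.toFinite _).measurableSet, Finset.prod_map]
    calc _ ≤ ∏ x ∈ Finset.range (X + 1), (1 - p) := by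
          refine Finset.prod_le_prod (fun _ _ => measureReal_nonneg) fun x hx => hmblue _ ?_
          rw [hmembox]
          have := Finset.mem_range.1 hx
          change |(x : ℤ)| ≤ Λ ∧ |(0 : ℤ)| ≤ M
          rw [abs_zero, Nat.abs_cast]
          omega
      _ = _ := by simp
  have hv0 : ∀ l, 0 ≤ 1 - (1 - (1 - p) ^ (ρ * Δ l)) ^ ρ := by
    intro l
    have h1 := pow_le_one₀ (n := ρ * Δ l) (by linarith : 0 ≤ 1 - p) (by linarith)
    have h2 := pow_nonneg (by linarith : 0 ≤ 1 - p) (ρ * Δ l)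
    have h3 := pow_le_one₀ (n := ρ) (by linarith : 0 ≤ 1 - (1 - p) ^ (ρ * Δ l)) (by linarith)
    linarith
  have hpbad : ∀ l < L, ∀ z ∈ Z l, ∀ j, ∀ σ ∈ ({1, -1} : Finset ℤ),
      μ.real (bad l z j σ) ≤ q * (1 - (1 - (1 - p) ^ (ρ * Δ l)) ^ ρ) ^ g l := by
    intro l hl z hz j σ hσ
    by_cases hjΛ : -(Λ : ℤ) ≤ (j + 2) * (w l) ∧ (j + 3) * (w l) ≤ (Λ : ℤ)
    · have hzM : (M : ℤ) < |z.2| := by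
        simp only [hZ, Finset.mem_product, Finset.mem_union, Finset.mem_Icc, Finset.mem_Ioc,
          Finset.mem_Ico] at hz
        rw [lt_abs]; omega
      have hset : bad l z j σ = {ω | (ω z).1 = Colour.red} ∩
          {ω | ¬ HasWall ω ρ (F (l + 1)) (F l) (w l) σ j} := by
        ext ω
        simp only [hbad, Set.mem_ofPred_eq, Set.mem_inter_iff]
        tauto
      have hσ' : σ = 1 ∨ σ = -1 := by simpa using hσ
      rw [hset, ← hmred z (by rw [hmembox]; omega)]
      refine prob_red_inter_noWall_le hp (by linarith) hσ' (hg l hl) (fun x y hx1 hx2 hy => ?_) ?_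
      · refine hmblue _ ((hmembox _).2 ⟨abs_le.2 ⟨hjΛ.1.trans hx1, hx2.le.trans hjΛ.2⟩, ?_⟩)
        have := hFM l
        rcases hσ' with rfl | rfl <;> simp only [one_mul, neg_one_mul, abs_neg, Nat.abs_cast] <;>
          omega
      · have : (F l : ℤ) ≤ M := by exact_mod_cast hFM l
        linarith
    · have hset : bad l z j σ = ∅ := by
        ext ω
        simp only [hbad, Set.mem_ofPred_eq, Set.mem_empty_iff_false, iff_false]
        tauto
      rw [hset, measureReal_empty]
      exact mul_nonneg hq (pow_nonneg (hv0 l) _)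
  have hpBad : μ.real Bad ≤ (1 - p) ^ (X + 1) +
      ∑ l ∈ Finset.range L, (2 * Λ + 1) * (2 * (ρ * t (l + 1))) * (2 * c + 1) * 2 *
        (q * (1 - (1 - (1 - p) ^ (ρ * Δ l)) ^ ρ) ^ g l) := by
    refine (measureReal_union_le _ _).trans (add_le_add hpnoBlue ?_)
    refine (measureReal_biUnion_finset_le _ _).trans (Finset.sum_le_sum fun l hl => ?_)
    have hl' := Finset.mem_range.1 hl
    set v := q * (1 - (1 - (1 - p) ^ (ρ * Δ l)) ^ ρ) ^ g l with hv
    have hv1 : 0 ≤ v := mul_nonneg hq (pow_nonneg (hv0 l) _)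
    calc μ.real (⋃ z ∈ Z l, ⋃ j ∈ J l z, ⋃ σ ∈ ({1, -1} : Finset ℤ), bad l z j σ)
        ≤ ∑ z ∈ Z l, ∑ j ∈ J l z, ∑ σ ∈ ({1, -1} : Finset ℤ), v := by
          refine (measureReal_biUnion_finset_le _ _).trans (Finset.sum_le_sum fun z hz => ?_)
          refine (measureReal_biUnion_finset_le _ _).trans (Finset.sum_le_sum fun j _ => ?_)
          exact (measureReal_biUnion_finset_le _ _).trans
            (Finset.sum_le_sum fun σ hσ => hpbad l hl' z hz j σ hσ)
      _ = ∑ z ∈ Z l, (2 * c + 1) * (2 * v) := by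
          refine Finset.sum_congr rfl fun z _ => ?_
          rw [Finset.sum_const, Finset.sum_const, hJ, Int.card_Icc,
            show (z.1 / (w l : ℤ) + c + 1 - (z.1 / w l - c)).toNat = 2 * c + 1 by omega]
          simp
      _ = (Z l).card * ((2 * c + 1) * (2 * v)) := by rw [Finset.sum_const, nsmul_eq_mul]
      _ ≤ ((2 * Λ + 1) * (2 * (ρ * t (l + 1)))) * ((2 * c + 1) * (2 * v)) := by
          gcongr
          have : (Z l).card ≤ (2 * Λ + 1) * (2 * (ρ * t (l + 1))) := by
            rw [hZ, Finset.card_product, Int.card_Icc,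
              show ((Λ : ℤ) + 1 - -(Λ : ℤ)).toNat = 2 * Λ + 1 by omega]
            refine Nat.mul_le_mul_left _ ((Finset.card_union_le _ _).trans ?_)
            rw [Int.card_Ioc, Int.card_Ico]
            have : (ρ : ℤ) * t (l + 1) = ((ρ * t (l + 1) : ℕ) : ℤ) := by push_cast; rfl
            rw [this]
            omega
          exact_mod_cast this
      _ = _ := by ring
  have hmain : (law p q).real (Set.pi box A ∩ Badᶜ) =
      (law p q).real (Set.pi box A) * μ.real Badᶜ := by
    rw [← hcond, mul_comm, measureReal_def, measureReal_def, measureReal_def, ← ENNReal.toReal_mul,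
      ProbabilityTheory.cond_mul_eq_inter hpm]
  have hboxp : (law p q).real (Set.pi box A) = (1 - q) ^ ((2 * Λ + 1) * (2 * M + 1)) := by
    rw [law_eq, infinitePi_real_pi fun _ _ => (Set.toFinite _).measurableSet,
      Finset.prod_congr rfl fun s hs => show (siteLaw p q).real (A s) = 1 - q by
        simp only [hA, if_pos hs]
        exact siteLaw_real_ne_red hp hq hpq, Finset.prod_const, hbox, Finset.card_product,
      Int.card_Icc, Int.card_Icc, show ((Λ : ℤ) + 1 - -(Λ : ℤ)).toNat = 2 * Λ + 1 by omega,
      show ((M : ℤ) + 1 - -(M : ℤ)).toNat = 2 * M + 1 by omega]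
  have hcompl : 1 - μ.real Bad ≤ μ.real Badᶜ := by
    have h2 := measureReal_union_le (μ := μ) Bad Badᶜ
    rw [Set.union_compl_self, probReal_univ] at h2
    linarith
  calc _ ≤ (1 - q) ^ ((2 * Λ + 1) * (2 * M + 1)) * μ.real Badᶜ := by
        refine mul_le_mul_of_nonneg_left ?_ (pow_nonneg (by linarith) _)
        linarith
    _ = (law p q).real (Set.pi box A ∩ Badᶜ) := by rw [hmain, hboxp]
    _ ≤ probBlue r {(1, 0)} (l1Ball ρ) p q := measureReal_mono hsub

end BlueWins

/-! ### Time layers with doubling durations -/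

section Layers

/-- The duration of the `l`-th layer: the `N` layers of scale `i` take `2 ^ i * d` red times each. -/
def layerStep (N d l : ℕ) : ℕ := 2 ^ (l / N) * d

/-- The number of red times before the `l`-th layer. -/
def layerTime (N d l : ℕ) : ℕ := 2 ^ (l / N) * (N + l % N) * d

variable {N : ℕ}

/-- Consecutive scales fit together because `N` layers of length `2 ^ i * d` double the time `2 ^ i
* N * d`. -/
theorem layerTime_succ (hN : 0 < N) (d l : ℕ) :
    layerTime N d (l + 1) = layerTime N d l + layerStep N d l := by
  obtain ⟨i, k, hk, rfl⟩ : ∃ i k, k < N ∧ l = N * i + k :=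
    ⟨l / N, l % N, Nat.mod_lt _ hN, (Nat.div_add_mod l N).symm⟩
  have h1 : (N * i + k) / N = i := by rw [Nat.mul_add_div hN, Nat.div_eq_of_lt hk, add_zero]
  have h2 : (N * i + k) % N = k := by rw [Nat.mul_add_mod, Nat.mod_eq_of_lt hk]
  rcases Nat.lt_or_ge (k + 1) N with h | h
  · have h3 : (N * i + k + 1) / N = i := by
      rw [add_assoc, Nat.mul_add_div hN, Nat.div_eq_of_lt h, add_zero]
    have h4 : (N * i + k + 1) % N = k + 1 := by
      rw [add_assoc, Nat.mul_add_mod, Nat.mod_eq_of_lt h]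
    simp only [layerTime, layerStep, h1, h2, h3, h4]
    ring
  · have hkN : k + 1 = N := by omega
    have h3 : (N * i + k + 1) / N = i + 1 := by
      rw [add_assoc, hkN, Nat.mul_add_div hN, Nat.div_self hN]
    have h4 : (N * i + k + 1) % N = 0 := by
      rw [add_assoc, hkN, Nat.mul_add_mod, Nat.mod_self]
    simp only [layerTime, layerStep, h1, h2, h3, h4]
    rw [← hkN]
    ring

/-- The elapsed time is between `N` and `2 * N` layer steps: enough for blue to fill the cells, and
so little that a red vertex meets a bounded number of them. -/
theorem mul_layerStep_le (d l : ℕ) : N * layerStep N d l ≤ layerTime N d l := by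
  rw [layerTime, layerStep, show N * (2 ^ (l / N) * d) = 2 ^ (l / N) * N * d by ring]
  gcongr
  omega

theorem layerTime_le (hN : 0 < N) (d l : ℕ) : layerTime N d l ≤ 2 * N * layerStep N d l := by
  rw [layerTime, layerStep, show 2 * N * (2 ^ (l / N) * d) = 2 ^ (l / N) * (2 * N) * d by ring]
  have := (Nat.mod_lt l hN).le
  gcongr
  omega

theorem layerTime_mul (hN : 0 < N) (d I : ℕ) : layerTime N d (N * I) = 2 ^ I * N * d := by
  simp [layerTime, Nat.mul_div_cancel_left I hN]

theorem layerTime_mono (hN : 0 < N) (d : ℕ) : Monotone (layerTime N d) :=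
  monotone_nat_of_le_succ fun l => by rw [layerTime_succ hN]; exact Nat.le_add_right _ _

theorem sum_range_mul_div (hN : 0 < N) (f : ℕ → ℝ) (I : ℕ) :
    ∑ l ∈ Finset.range (N * I), f (l / N) = N * ∑ i ∈ Finset.range I, f i := by
  induction I with
  | zero => simp
  | succ I ih =>
    rw [mul_add, mul_one, Finset.sum_range_add, ih, Finset.sum_range_succ, mul_add]
    congr 1
    rw [Finset.sum_congr rfl fun k hk => by
      rw [Nat.mul_add_div hN, Nat.div_eq_of_lt (Finset.mem_range.1 hk), add_zero]]
    simp

theorem sum_geometric_le {x : ℝ} (hx : 0 ≤ x) (hx1 : x < 1) (I : ℕ) :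
    ∑ i ∈ Finset.range I, x ^ i ≤ 1 / (1 - x) := by
  rw [one_div, ← tsum_geometric_of_lt_one hx hx1]
  exact (summable_geometric_of_lt_one hx hx1).sum_le_tsum _ fun i _ => by positivity

end Layers

/-! ### Elementary inequalities -/

section Estimates

theorem one_sub_pow_le_exp {p : ℝ} (hp1 : p ≤ 1) (n : ℕ) :
    (1 - p) ^ n ≤ Real.exp (-(p * n)) := by
  calc (1 - p) ^ n ≤ Real.exp (-p) ^ n := by
        gcongr
        linarith [Real.add_one_le_exp (-p)]
    _ = _ := by rw [← Real.exp_nat_mul]; ring_nf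

theorem exp_neg_le_one_div {x : ℝ} (hx : 0 ≤ x) : Real.exp (-x) ≤ 1 / (1 + x) := by
  rw [Real.exp_neg, ← one_div]
  have := Real.add_one_le_exp x
  exact one_div_le_one_div_of_le (by linarith) (by linarith)

theorem le_one_sub_one_sub_pow {p b : ℝ} (hp : 0 ≤ p) (hp1 : p ≤ 1) {n : ℕ} (hb : p * n ≤ b) :
    p * n / (1 + b) ≤ 1 - (1 - p) ^ n := by
  have h0 : 0 ≤ p * n := by positivity
  have h1 := (one_sub_pow_le_exp hp1 n).trans (exp_neg_le_one_div h0)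
  have h2 : p * n / (1 + b) ≤ p * n / (1 + p * n) := by gcongr
  have h3 : p * n / (1 + p * n) = 1 - 1 / (1 + p * n) := by field_simp; ring
  linarith

theorem exp_neg_two_mul_le {q : ℝ} (hq : 0 ≤ q) (hq1 : q ≤ 1 / 2) : Real.exp (-(2 * q)) ≤ 1 - q := by
  refine (exp_neg_le_one_div (by linarith)).trans ?_
  rw [div_le_iff₀ (by linarith)]
  nlinarith

/-- With `x` growing like `(4 / 3) ^ i`, the cube is the least integer power that beats the factor
`2 ^ i` from the number of red vertices: `2 * 27 / 64 < 1 < 2 * 9 / 16`. -/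
theorem exp_neg_le_six_div_cube {x : ℝ} (hx : 0 < x) : Real.exp (-x) ≤ 6 / x ^ 3 := by
  have h := Real.pow_div_factorial_le_exp x hx.le 3
  rw [Real.exp_neg, inv_le_comm₀ (Real.exp_pos x) (by positivity), inv_div]
  simpa [Nat.factorial] using h

/-- The probability that a cell holds no wall, with the parameters of scale `i`. -/
theorem noWall_le {u κ G h : ℝ} {ρ g i : ℕ} (hρ : 1 ≤ ρ) (hh : 0 < h) (hκ : 0 < κ) (hG : 0 < G)
    (hu : κ * 2 ^ i * h ≤ u) (hu1 : u ≤ 1) (hg : G / h ^ ρ * (2 / 3) ^ i ≤ g) :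
    (1 - u ^ ρ) ^ g ≤ 6 / (κ ^ ρ * G) ^ 3 * (27 / 64) ^ i := by
  have hu0 : 0 ≤ u := le_trans (by positivity) hu
  -- Only one factor `2 ^ i` of `(2 ^ i) ^ ρ` is kept. Against the `(2 / 3) ^ i` in `g` it leaves
  -- growth `(4 / 3) ^ i` for every `ρ`.
  have h1 : κ ^ ρ * 2 ^ i * h ^ ρ ≤ u ^ ρ := by
    calc κ ^ ρ * 2 ^ i * h ^ ρ ≤ κ ^ ρ * (2 ^ i) ^ ρ * h ^ ρ := by
          gcongr
          exact le_self_pow₀ (one_le_pow₀ (by norm_num)) (by omega)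
      _ = (κ * 2 ^ i * h) ^ ρ := by rw [mul_pow, mul_pow]
      _ ≤ u ^ ρ := by gcongr
  have h2 : κ ^ ρ * G * (4 / 3) ^ i ≤ u ^ ρ * g := by
    calc κ ^ ρ * G * (4 / 3) ^ i = (κ ^ ρ * 2 ^ i * h ^ ρ) * (G / h ^ ρ * (2 / 3) ^ i) := by
          rw [show (4 / 3 : ℝ) = 2 * (2 / 3) by norm_num, mul_pow]
          field_simp
      _ ≤ u ^ ρ * g := by gcongr
  calc (1 - u ^ ρ) ^ g ≤ Real.exp (-(u ^ ρ * g)) := one_sub_pow_le_exp (pow_le_one₀ hu0 hu1) g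
    _ ≤ Real.exp (-(κ ^ ρ * G * (4 / 3) ^ i)) := by gcongr
    _ ≤ 6 / (κ ^ ρ * G * (4 / 3) ^ i) ^ 3 := exp_neg_le_six_div_cube (by positivity)
    _ = _ := by
      rw [mul_pow, ← pow_mul, mul_comm i 3, pow_mul, div_mul_eq_div_div, div_eq_mul_inv _ (_ ^ i),
        ← inv_pow]
      norm_num

end Estimates

/-! ### Scaling limit of the lower bound -/

section BlueAsymptotics

theorem exists_pow_two_mul_ge {b y : ℝ} (hb : 0 < b) (hy : 0 < y) :
    ∃ I : ℕ, y ≤ 2 ^ I * b ∧ 2 ^ I * b ≤ 2 * (b + y) := by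
  obtain ⟨n, h1, h2⟩ := exists_nat_pow_near (x := max 1 (y / b)) (y := (2 : ℝ))
    (le_max_left _ _) (by norm_num)
  refine ⟨n + 1, ?_, ?_⟩
  · have := (le_max_right 1 (y / b)).trans h2.le
    rwa [div_le_iff₀ hb] at this
  · have h3 : max 1 (y / b) ≤ 1 + y / b :=
      max_le (by have : 0 ≤ y / b := by positivity
                 linarith) (by linarith)
    calc (2 : ℝ) ^ (n + 1) * b = 2 * (2 ^ n * b) := by ring
      _ ≤ 2 * ((1 + y / b) * b) := by gcongr; exact h1.trans h3
      _ = _ := by field_simp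

-- The order of the constants is the point: `K₂` does not depend on `G`, so a large `G` makes the
-- error `a * K₂ / G ^ 3` small for any `a`. The price is a higher red-free box, which enters only
-- through `K`.
set_option maxHeartbeats 2000000 in
theorem exists_le_probBlue {r : ℝ} (hr : 0 < r) {ρ : ℕ} (hρ : 1 ≤ ρ) {C : ℝ} (hC : 0 < C) :
    ∃ K₂ : ℝ, 0 < K₂ ∧ ∀ G : ℝ, 1 ≤ G → ∃ K : ℝ, ∀ a : ℝ, 0 < a →
      0 ≤ 1 - Real.exp (-C) - a * K₂ / G ^ 3 →
      ∀ᶠ p : ℝ in 𝓝[>] 0, Real.exp (-(a * K)) * (1 - Real.exp (-C) - a * K₂ / G ^ 3) ≤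
        probBlue r {(1, 0)} (l1Ball ρ) p (a * p ^ (1 + (ρ : ℝ) / ((ρ : ℝ) + 1))) := by
  -- Then `4 * ρ * Δ l + 1 ≤ 5 * ρ * Δ l ≤ r * N * Δ l ≤ r * t l`, the time that blue needs in each
  -- layer.
  obtain ⟨N, hN5⟩ : ∃ N : ℕ, 5 * ρ / r ≤ N := exists_nat_ge _
  rw [div_le_iff₀ hr] at hN5
  have hρR : (1 : ℝ) ≤ ρ := by exact_mod_cast hρ
  have hN : 0 < N := by
    rcases Nat.eq_zero_or_pos N with h | h
    · rw [h] at hN5; simp only [Nat.cast_zero, zero_mul] at hN5; linarith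
    · exact h
  -- Rescaled bounds: `p * t L ≤ T₁`, `p * (2 * Λ + 1) ≤ 2 * Λ₁ + 1`, and later `h ^ ρ * (2 * M + 1)
  -- ≤ 2 * M₁ + 1`. The factor `κ` is the loss in replacing `1 - (1 - p) ^ n` by `p * n`. Only `M₁`
  -- involves `G`.
  set T₁ : ℝ := 2 * (2 * N + (C + 2) / r) with hT₁
  set Λ₁ : ℝ := C + 2 + 4 * (ρ * T₁) with hΛ₁
  set κ : ℝ := 1 / (1 + ρ * T₁) with hκ
  have hT₁0 : 0 < T₁ := by positivity
  have hκ0 : 0 < κ := by positivity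
  have hΛ₁0 : 0 < Λ₁ := by positivity
  set K₀ : ℝ := (2 * Λ₁ + 1) * (2 * ρ) * (2 * (2 * N + 1)) * (2 * (2 * N + 1) + 1) * 2 *
    (6 / (κ ^ ρ) ^ 3) with hK₀
  have hK₀0 : 0 < K₀ := by positivity
  refine ⟨N * (32 / 5) * K₀, by positivity, fun G hG => ?_⟩
  have hG0 : 0 < G := by linarith
  set M₁ : ℝ := 1 + ρ * (N * (3 * G + T₁)) + 2 * ρ * N with hM₁
  refine ⟨2 * ((2 * Λ₁ + 1) * (2 * M₁ + 1)), fun a ha hpos0 => ?_⟩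
  have hh0 : 0 < min (1 / 2) (1 / (2 * a + 2)) := by positivity
  filter_upwards [eventually_exists_scale ρ hh0] with p hp
  obtain ⟨h, hpos, hle, rfl, hq⟩ := hp
  rw [hq]
  have hhalf : h ≤ 1 / 2 := hle.trans (min_le_left _ _)
  have ha2 : h ≤ 1 / (2 * a + 2) := hle.trans (min_le_right _ _)
  have hh1 : h ≤ 1 := by linarith
  have hah : a * h ≤ 1 / 2 := by
    rw [le_div_iff₀ (by positivity)] at ha2
    nlinarith
  have hpow : ∀ k, 1 ≤ k → h ^ k ≤ h := fun k hk => pow_le_of_le_one hpos.le hh1 (by omega)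
  have hqle : a * h ^ (2 * ρ + 1) ≤ 1 / 2 :=
    (mul_le_mul_of_nonneg_left (hpow _ (by omega)) ha.le).trans hah
  have hp2 : h ^ (ρ + 1) ≤ 1 / 2 := (hpow _ (by omega)).trans hhalf
  have hp0 : 0 < h ^ (ρ + 1) := by positivity
  have hq0 : 0 < a * h ^ (2 * ρ + 1) := by positivity
  have hρ0 : 0 < h ^ ρ := by positivity
  have hρ1 : h ^ ρ ≤ 1 := (hpow ρ hρ).trans hh1
  have hqp : a * h ^ (2 * ρ + 1) = a * (h ^ (ρ + 1) * h ^ ρ) := by ring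
  have hph : h ^ (ρ + 1) = h * h ^ ρ := by ring
  set p := h ^ (ρ + 1) with hpdef
  set q := a * h ^ (2 * ρ + 1) with hqdef
  set d : ℕ := ⌈1 / h ^ ρ⌉₊ with hd
  have hd1 : 1 / h ^ ρ ≤ d := Nat.le_ceil _
  have hd2 : (d : ℝ) < 1 / h ^ ρ + 1 := Nat.ceil_lt_add_one (by positivity)
  have hdpos : 0 < d := Nat.ceil_pos.2 (by positivity)
  have hdh1 : 1 ≤ h ^ ρ * d := by
    rw [div_le_iff₀ hρ0] at hd1; linarith
  have hdh2 : h ^ ρ * d ≤ 2 := by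
    have : h ^ ρ * d ≤ h ^ ρ * (1 / h ^ ρ + 1) := by gcongr
    rw [mul_add, mul_one_div_cancel hρ0.ne'] at this
    linarith
  have hpd : p * d ≤ 2 := by
    rw [hph, mul_assoc]
    calc h * (h ^ ρ * d) ≤ 1 * 2 := by gcongr
      _ = 2 := by norm_num
  set X : ℕ := ⌈C / p⌉₊ with hX
  have hX1 : C / p ≤ X := Nat.le_ceil _
  have hX2 : (X : ℝ) < C / p + 1 := Nat.ceil_lt_add_one (by positivity)
  have hpX1 : C ≤ p * X := by rw [div_le_iff₀ hp0] at hX1; linarith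
  have hpX2 : p * (X + 1) ≤ C + 2 := by
    have : p * (X + 1) ≤ p * (C / p + 2) := mul_le_mul_of_nonneg_left (by linarith) hp0.le
    rw [mul_add p (C / p), mul_div_cancel₀ _ hp0.ne'] at this
    linarith
  -- The number of scales: the final time `2 ^ I * N * d` lets blue cross `X`, yet stays of order `1
  -- / p`.
  obtain ⟨I, hI1, hI2⟩ := exists_pow_two_mul_ge (b := N * d) (y := (X + 1) / r) (by positivity)
    (by positivity)
  set t := layerTime N d with ht
  set Δ := layerStep N d with hΔ
  set L := N * I with hL
  have htL : (t L : ℝ) = 2 ^ I * (N * d) := by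
    rw [ht, hL, layerTime_mul hN]; push_cast; ring
  have hptL : p * t L ≤ T₁ := by
    rw [htL]
    calc p * (2 ^ I * (N * d)) ≤ p * (2 * (N * d + (X + 1) / r)) := by gcongr
      _ = 2 * (N * (p * d) + (p * (X + 1)) / r) := by ring
      _ ≤ 2 * (N * 2 + (C + 2) / r) := by gcongr
      _ = T₁ := by rw [hT₁]; ring
  set g : ℕ → ℕ := fun l => ⌈G / h ^ ρ * (2 / 3) ^ (l / N)⌉₊ with hg
  -- The summand 1 leaves row 0 in the strip after the last layer; beyond `L` the interval is empty
  -- and `F` is constant.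
  set F : ℕ → ℕ := fun l => 1 + ∑ k ∈ Finset.Ico l L, ρ * g k with hF
  set M : ℕ := F 0 + ρ * t 0 with hM
  set Λ : ℕ := X + 4 * (ρ * t L) with hΛ
  have hFsucc : ∀ l < L, F l = F (l + 1) + ρ * g l := by
    intro l hl
    simp only [hF]
    rw [Finset.sum_eq_sum_Ico_succ_bot hl]
    ring
  have hFle : ∀ l, F (l + 1) ≤ F l := by
    intro l
    rcases Nat.lt_or_ge l L with hl | hl
    · rw [hFsucc l hl]; exact Nat.le_add_right _ _
    · simp only [hF]
      rw [Finset.Ico_eq_empty_of_le hl, Finset.Ico_eq_empty_of_le (by omega)]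
  have hΔpos : ∀ l, 0 < Δ l := fun l => by
    simp only [hΔ, layerStep]; positivity
  have hNΔ : ∀ l, (N : ℝ) * Δ l ≤ t l := fun l => by
    exact_mod_cast mul_layerStep_le (N := N) d l
  have key := le_probBlue hr hp0.le hq0.le (by linarith) (by linarith) (ρ := ρ) (M := M) (L := L)
    (Λ := Λ) (c := 2 * N + 1) (X := X) (t := t) (F := F) (Δ := Δ) (g := g)
    (layerTime_succ hN d) hFle le_rfl (fun l hl => (hFsucc l hl).ge)
    (fun l => Nat.mul_pos (by omega) (hΔpos l)) (fun l => by
      have h1 : (1 : ℝ) ≤ ρ * Δ l := by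
        exact_mod_cast Nat.mul_pos (show 0 < ρ by omega) (hΔpos l)
      have h2 : (5 * ρ : ℝ) * Δ l ≤ N * r * Δ l := by gcongr
      have h3 : r * (N * Δ l) ≤ r * t l := by gcongr; exact hNΔ l
      push_cast
      nlinarith) (fun l => by
      have := layerTime_le hN d l
      calc ρ * t l + ρ * Δ l ≤ ρ * (2 * N * Δ l) + ρ * Δ l := by gcongr
        _ = _ := by ring) (by simp [hF]) (by
      rw [htL]
      rw [div_le_iff₀ hr] at hI1
      linarith) le_rfl
  refine le_trans ?_ key
  have hpΛ : p * (2 * Λ + 1) ≤ 2 * Λ₁ + 1 := by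
    rw [hΛ]
    push_cast
    calc p * (2 * (X + 4 * (ρ * t L)) + 1) = 2 * (p * (X + 1) + 4 * (ρ * (p * t L))) - p := by ring
      _ ≤ 2 * (C + 2 + 4 * (ρ * T₁)) + 1 := by
        have : p * (X + 1) + 4 * (ρ * (p * t L)) ≤ C + 2 + 4 * (ρ * T₁) := by gcongr
        linarith
      _ = _ := by rw [hΛ₁]
  -- The ceilings in `g` may cost one group in each of the `N * I` layers; this bound keeps their
  -- total of order `h ^ (-ρ)`.
  have hhI : h ^ ρ * I ≤ T₁ := by
    have h1 : (I : ℝ) ≤ 2 ^ I := by exact_mod_cast (Nat.lt_two_pow_self (n := I)).le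
    have hN1 : (1 : ℝ) ≤ N := by exact_mod_cast hN
    calc h ^ ρ * I ≤ h ^ ρ * 2 ^ I := by gcongr
      _ = (h ^ ρ * 2 ^ I) * (1 * 1) := by ring
      _ ≤ (h ^ ρ * 2 ^ I) * (N * (h ^ ρ * d)) := by gcongr
      _ = (h ^ ρ * h ^ ρ) * (2 ^ I * (N * d)) := by ring
      _ ≤ (h * h ^ ρ) * (2 ^ I * (N * d)) := by gcongr; exact hpow ρ hρ
      _ = p * t L := by rw [htL, hph]
      _ ≤ T₁ := hptL
  have hhM : h ^ ρ * (2 * M + 1) ≤ 2 * M₁ + 1 := by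
    have hsum : ∑ l ∈ Finset.range L, (g l : ℝ) ≤ N * (G / h ^ ρ * 3 + I) := by
      calc ∑ l ∈ Finset.range L, (g l : ℝ)
          ≤ ∑ l ∈ Finset.range L, (G / h ^ ρ * (2 / 3) ^ (l / N) + 1) :=
            Finset.sum_le_sum fun l _ => (Nat.ceil_lt_add_one (by positivity)).le
        _ = N * ∑ i ∈ Finset.range I, (G / h ^ ρ * (2 / 3) ^ i + 1) :=
            sum_range_mul_div hN (fun i => G / h ^ ρ * (2 / 3) ^ i + 1) I
        _ ≤ _ := by
            rw [Finset.sum_add_distrib, ← Finset.mul_sum]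
            have := sum_geometric_le (x := 2 / 3) (by norm_num) (by norm_num) I
            norm_num at this
            gcongr
            simp
    have hM0 : (M : ℝ) = 1 + ρ * ∑ l ∈ Finset.range L, (g l : ℝ) + ρ * (N * d) := by
      have : t 0 = N * d := by simp [ht, layerTime]
      rw [hM, this, hF]
      push_cast
      rw [Finset.mul_sum, ← Finset.range_eq_Ico]
    have h1 : h ^ ρ * M ≤ M₁ := by
      calc h ^ ρ * M ≤ h ^ ρ * (1 + ρ * (N * (G / h ^ ρ * 3 + I)) + ρ * (N * d)) := by
            rw [hM0]; gcongr
        _ = h ^ ρ + ρ * (N * (3 * G + h ^ ρ * I)) + ρ * N * (h ^ ρ * d) := by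
            field_simp
        _ ≤ 1 + ρ * (N * (3 * G + T₁)) + ρ * N * 2 := by gcongr
        _ = M₁ := by rw [hM₁]; ring
    linarith
  have hbox : Real.exp (-(a * (2 * ((2 * Λ₁ + 1) * (2 * M₁ + 1))))) ≤
      (1 - q) ^ ((2 * Λ + 1) * (2 * M + 1)) := by
    calc _ ≤ Real.exp (-(2 * (q * ((2 * Λ + 1) * (2 * M + 1))))) := by
          rw [Real.exp_le_exp, neg_le_neg_iff]
          calc 2 * (q * ((2 * Λ + 1) * (2 * M + 1)))
              = a * (2 * ((p * (2 * Λ + 1)) * (h ^ ρ * (2 * M + 1)))) := by rw [hqp]; ring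
            _ ≤ _ := by gcongr
      _ = Real.exp (-(2 * q)) ^ ((2 * Λ + 1) * (2 * M + 1)) := by
          rw [← Real.exp_nat_mul]; push_cast; ring_nf
      _ ≤ _ := by gcongr; exact exp_neg_two_mul_le hq0.le hqle
  have hrow : (1 - p) ^ (X + 1) ≤ Real.exp (-C) := by
    calc (1 - p) ^ (X + 1) ≤ (1 - p) ^ X :=
          pow_le_pow_of_le_one (by linarith) (by linarith) (by omega)
      _ ≤ Real.exp (-(p * X)) := one_sub_pow_le_exp (by linarith) X
      _ ≤ _ := by gcongr
  have hterm : ∀ l ∈ Finset.range L,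
      (2 * (Λ : ℝ) + 1) * (2 * (ρ * t (l + 1))) * (2 * ((2 * N + 1 : ℕ) : ℝ) + 1) * 2 *
        (q * (1 - (1 - (1 - p) ^ (ρ * Δ l)) ^ ρ) ^ g l) ≤ a * K₀ / G ^ 3 * (27 / 32) ^ (l / N) := by
    intro l hl
    have hlL := (Finset.mem_range.1 hl).le
    have hΔl : (Δ l : ℝ) = 2 ^ (l / N) * d := by
      simp only [hΔ, layerStep]; push_cast; rfl
    have hwb : p * (ρ * Δ l : ℕ) ≤ ρ * T₁ := by
      have h1 : Δ l ≤ t L := by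
        refine le_trans ?_ (layerTime_mono hN d hlL)
        exact (Nat.le_mul_of_pos_left _ hN).trans (mul_layerStep_le d l)
      have h2 : (Δ l : ℝ) ≤ t L := by exact_mod_cast h1
      calc p * (ρ * Δ l : ℕ) = ρ * (p * Δ l) := by push_cast; ring
        _ ≤ ρ * (p * t L) := by gcongr
        _ ≤ _ := by gcongr
    have hu : κ * 2 ^ (l / N) * h ≤ 1 - (1 - p) ^ (ρ * Δ l) := by
      refine le_trans ?_ (le_one_sub_one_sub_pow hp0.le (by linarith) hwb)
      have h1 : 2 ^ (l / N) * h ≤ p * (ρ * Δ l : ℕ) := by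
        push_cast
        rw [hΔl, hph]
        calc 2 ^ (l / N) * h = 2 ^ (l / N) * h * (1 * 1) := by ring
          _ ≤ 2 ^ (l / N) * h * (ρ * (h ^ ρ * d)) := by gcongr
          _ = _ := by ring
      calc κ * 2 ^ (l / N) * h = (2 ^ (l / N) * h) / (1 + ρ * T₁) := by rw [hκ]; ring
        _ ≤ _ := by gcongr
    have hv := noWall_le hρ hpos hκ0 hG0 hu (by
      have := pow_nonneg (by linarith : 0 ≤ 1 - p) (ρ * Δ l)
      linarith) (g := g l) (Nat.le_ceil _)
    have htsucc : h ^ ρ * t (l + 1) ≤ 2 * (2 * N + 1) * 2 ^ (l / N) := by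
      have h1 : t (l + 1) ≤ (2 * N + 1) * Δ l := by
        rw [ht, layerTime_succ hN]
        have := layerTime_le hN d l
        rw [add_mul, one_mul]
        exact Nat.add_le_add_right this _
      have h2 : (t (l + 1) : ℝ) ≤ (2 * N + 1) * Δ l := by exact_mod_cast h1
      calc h ^ ρ * t (l + 1) ≤ h ^ ρ * ((2 * N + 1) * Δ l) := by gcongr
        _ = (2 * N + 1) * 2 ^ (l / N) * (h ^ ρ * d) := by rw [hΔl]; ring
        _ ≤ (2 * N + 1) * 2 ^ (l / N) * 2 := by gcongr
        _ = _ := by ring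
    set v := (1 - (1 - (1 - p) ^ (ρ * Δ l)) ^ ρ) ^ g l with hvdef
    calc _ = a * (p * (2 * Λ + 1)) * (2 * ρ) * (h ^ ρ * t (l + 1)) * (2 * (2 * N + 1) + 1) * 2 *
          v := by
          rw [hqp]; push_cast; ring
      _ ≤ a * (p * (2 * Λ + 1)) * (2 * ρ) * (h ^ ρ * t (l + 1)) * (2 * (2 * N + 1) + 1) * 2 *
          (6 / (κ ^ ρ * G) ^ 3 * (27 / 64) ^ (l / N)) := by gcongr
      _ ≤ a * (2 * Λ₁ + 1) * (2 * ρ) * (2 * (2 * N + 1) * 2 ^ (l / N)) * (2 * (2 * N + 1) + 1) * 2 *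
          (6 / (κ ^ ρ * G) ^ 3 * (27 / 64) ^ (l / N)) := by gcongr
      _ = a * K₀ / G ^ 3 * (2 ^ (l / N) * (27 / 64) ^ (l / N)) := by
          rw [hK₀, mul_pow (κ ^ ρ)]; field_simp
      _ = _ := by rw [← mul_pow]; norm_num
  have hsum := Finset.sum_le_sum hterm
  have hgeo : ∑ l ∈ Finset.range L, a * K₀ / G ^ 3 * (27 / 32 : ℝ) ^ (l / N) ≤
      a * (N * (32 / 5) * K₀) / G ^ 3 := by
    rw [← Finset.mul_sum, sum_range_mul_div hN (fun i => (27 / 32 : ℝ) ^ i) I]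
    have h1 := sum_geometric_le (x := 27 / 32) (by norm_num) (by norm_num) I
    norm_num at h1
    calc a * K₀ / G ^ 3 * (N * ∑ i ∈ Finset.range I, (27 / 32 : ℝ) ^ i)
        ≤ a * K₀ / G ^ 3 * (N * (32 / 5)) := by gcongr
      _ = _ := by ring
  refine mul_le_mul hbox ?_ hpos0 (pow_nonneg (by linarith) _)
  linarith

theorem liminf_probBlue {r : ℝ} (hr : 0 < r) {ρ : ℕ} (hρ : 1 ≤ ρ) :
    (∀ a : ℝ, 0 < a →
        0 < liminf (fun p : ℝ => probBlue r {((1, 0) : ℤ × ℤ)} (l1Ball ρ) p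
          (a * p ^ (1 + (ρ : ℝ) / ((ρ : ℝ) + 1)))) (𝓝[>] 0)) ∧
      Tendsto (fun a : ℝ => liminf (fun p : ℝ => probBlue r {((1, 0) : ℤ × ℤ)} (l1Ball ρ) p
        (a * p ^ (1 + (ρ : ℝ) / ((ρ : ℝ) + 1)))) (𝓝[>] 0)) (𝓝[>] 0) (𝓝 1) := by
  have hcob : ∀ a : ℝ, 0 < a → IsCoboundedUnder (· ≥ ·) (𝓝[>] (0 : ℝ)) (fun p : ℝ =>
      probBlue r {((1, 0) : ℤ × ℤ)} (l1Ball ρ) p (a * p ^ (1 + (ρ : ℝ) / ((ρ : ℝ) + 1)))) :=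
    fun a ha => (isBoundedUnder_of_eventually_le
      (eventually_probBlue_le_one _ _ _ ρ ha)).isCoboundedUnder_flip
  refine ⟨fun a ha => ?_, ?_⟩
  · obtain ⟨K₂, hK₂, hG⟩ := exists_le_probBlue hr hρ (C := 1) one_pos
    -- Since `4 * a * K₂ ≤ G ≤ G ^ 3`, the error is at most `1 / 4`, while `1 - Real.exp (-1) ≥ 1 /
    -- 2`.
    set G := max 1 (4 * a * K₂) with hGdef
    have hG1 : 1 ≤ G := le_max_left _ _
    obtain ⟨K, hK⟩ := hG G hG1
    have he : Real.exp (-1) ≤ 1 / 2 := by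
      have := exp_neg_le_one_div (x := 1) (by norm_num)
      norm_num at this ⊢
      exact this
    have hq : a * K₂ / G ^ 3 ≤ 1 / 4 := by
      rw [div_le_iff₀ (by positivity)]
      have h1 : 4 * a * K₂ ≤ G := le_max_right _ _
      have h2 : G ≤ G ^ 3 := le_self_pow₀ hG1 (by norm_num)
      linarith
    have h1 := le_liminf_of_le (hcob a ha) (hK a ha (by linarith))
    refine lt_of_lt_of_le (mul_pos (Real.exp_pos _) (by linarith)) h1
  · rw [tendsto_order]
    constructor
    · intro b hb
      obtain ⟨C, hC0, hC⟩ : ∃ C : ℝ, 0 < C ∧ Real.exp (-C) < (1 - b) / 2 := by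
        have h1 := (Real.tendsto_exp_neg_atTop_nhds_zero.eventually_lt_const
          (show (0 : ℝ) < (1 - b) / 2 by linarith)).and (eventually_gt_atTop 0)
        obtain ⟨C, h2, h3⟩ := h1.exists
        exact ⟨C, h3, h2⟩
      obtain ⟨K₂, hK₂, hG⟩ := exists_le_probBlue hr hρ hC0
      -- For `a → 0` no large `G` is needed: with `C` and `G = 1` fixed, the bound tends to `1 -
      -- Real.exp (-C) > b`.
      obtain ⟨K, hK⟩ := hG 1 le_rfl
      have hlim : Tendsto (fun a : ℝ => Real.exp (-(a * K)) *
          (1 - Real.exp (-C) - a * K₂ / 1 ^ 3)) (𝓝[>] 0) (𝓝 (1 - Real.exp (-C))) := by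
        have hcont : Continuous (fun a : ℝ => Real.exp (-(a * K)) *
          (1 - Real.exp (-C) - a * K₂ / 1 ^ 3)) := by fun_prop
        have := (hcont.tendsto 0).mono_left (nhdsWithin_le_nhds (s := Set.Ioi 0))
        simpa using this
      have hlim2 : Tendsto (fun a : ℝ => 1 - Real.exp (-C) - a * K₂ / 1 ^ 3) (𝓝[>] 0)
          (𝓝 (1 - Real.exp (-C))) := by
        have hcont : Continuous (fun a : ℝ => 1 - Real.exp (-C) - a * K₂ / 1 ^ 3) := by fun_prop
        have := (hcont.tendsto 0).mono_left (nhdsWithin_le_nhds (s := Set.Ioi 0))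
        simpa using this
      have hpos : 0 < 1 - Real.exp (-C) := by
        have := Real.exp_lt_one_iff.2 (by linarith : -C < 0)
        linarith
      filter_upwards [hlim.eventually_const_lt (show b < 1 - Real.exp (-C) by linarith),
        hlim2.eventually_const_lt hpos, self_mem_nhdsWithin] with a h1 h2 ha
      exact h1.trans_le (le_liminf_of_le (hcob a ha) (hK a ha h2.le))
    · intro b hb
      filter_upwards [self_mem_nhdsWithin] with a ha
      refine lt_of_le_of_lt ?_ hb
      exact liminf_le_of_frequently_le (eventually_probBlue_le_one _ _ _ ρ ha).frequently
        (isBoundedUnder_of ⟨0, fun p => probBlue_nonneg _ _ _ _ _⟩)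

end BlueAsymptotics

end CompetingGrowth

open CompetingGrowth in
theorem theorem1p2 (ρ : ℕ) (hρ : 1 ≤ ρ) (r : ℝ) (hr : 0 < r) :
    (∀ B : Set (ℤ × ℤ), B.Finite → (∀ b ∈ B, b.2 = 0) → ((1, 0) : ℤ × ℤ) ∈ B →
      ∀ p q : ℝ, 0 ≤ p → 0 ≤ q → p + q ≤ 1 → ¬ (p = 0 ∧ q = 0) →
        ∀ᵐ ω ∂(law p q), ∀ x : ℤ × ℤ, EventuallyNonempty r B (l1Ball ρ) ω x) ∧
    (∀ τ : ℕ, 1 ≤ τ →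
      (∀ a : ℝ, 0 < a →
        limsup (fun p : ℝ => probBlue r (segment τ) (l1Ball ρ) p
          (a * p ^ (1 + (ρ : ℝ) / ((ρ : ℝ) + 1)))) (𝓝[>] 0) < 1) ∧
      Tendsto (fun a : ℝ => limsup (fun p : ℝ => probBlue r (segment τ) (l1Ball ρ) p
        (a * p ^ (1 + (ρ : ℝ) / ((ρ : ℝ) + 1)))) (𝓝[>] 0)) atTop (𝓝 0)) ∧
    ((∀ a : ℝ, 0 < a →
        0 < liminf (fun p : ℝ => probBlue r {((1, 0) : ℤ × ℤ)} (l1Ball ρ) p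
          (a * p ^ (1 + (ρ : ℝ) / ((ρ : ℝ) + 1)))) (𝓝[>] 0)) ∧
      Tendsto (fun a : ℝ => liminf (fun p : ℝ => probBlue r {((1, 0) : ℤ × ℤ)} (l1Ball ρ) p
        (a * p ^ (1 + (ρ : ℝ) / ((ρ : ℝ) + 1)))) (𝓝[>] 0)) (𝓝[>] 0) (𝓝 1)) := by
  refine ⟨fun B _ _ hB p q hp hq hpq h0 => ae_eventuallyNonempty hr hρ hB hp hq hpq h0,
    fun τ _ => limsup_probBlue r hr τ ρ hρ, liminf_probBlue hr hρ⟩
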